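/- Let $d,n$ be positive integers, let $p$ be an integer with $0\le p<d$, let $a=(a_1,\dots,a_n)\in\mathbb{Z}_{\ge0}^n$ with $a_1+\cdots+a_n=d$, and let $\alpha=(\alpha_1,\dots,\alpha_n)\in\mathbb{C}^n$. Assume $\operatorname{Re}(\alpha_i-a_i)>0$ whenever $a_i\neq0$, and $\alpha_i\notin\mathbb{Z}_{\le 0}$ whenever $a_i=0$. For $v\in\mathbb{C}^n$ write $\Gamma(v)=\prod_{i=1}^n\Gamma(v_i)$; put $(1-s)_p=(1-s)(2-s)\cdots(p-s)$ and $w=e^{-\pi\sqrt{-1}/d}\zeta$. Let $\Sigma$ be the set of all $\zeta\in\mathbb{C}\setminus\{0\}$ with $|\arg w|<\pi/d$; on $\Sigma$ the powers of $w$ are taken with the principal branch. Let $$\varphi_p(\zeta)=\sum_{k=0}^\infty\frac{\Gamma(\alpha+ka)}{\Gamma(1+p+dk)}\zeta^{dk},$$ $$F(s)=\frac{\Gamma(s)\prod_{i=1}^{d-1}\sin\frac{\pi(s+i)}{d}}{(1-s)_p}\,\Gamma\!\left(\alpha-\tfrac{a}{d}s\right)w^{-s},$$ $$G(s)=\Gamma(ds)\prod_{i=1}^{d-1}\sin\!\left(\pi\!\left(s+\tfrac{p+i}{d}\right)\right)\Gamma\!\left(\alpha-\tfrac{p}{d}a-as\right)w^{-ds-p}.$$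 Let $C$ be the set of all real $c>0$ such that the line $\operatorname{Re}s=c$ lies to the left of all poles of $\Gamma(\alpha-\frac pd a-as)$, that is, $a_i(c+\frac pd)<\operatorname{Re}\alpha_i$ for all $i$ with $a_i\ne0$ (in particular, every $c$ with $0<c\le1-\frac pd$ belongs to $C$). (i) For all $c\in C$ and $\zeta\in\Sigma$, both integrals below converge absolutely, and they are equal: $$I_p(\zeta):=\frac{1}{2\pi\sqrt{-1}}\frac{2^{d-1}}{d}\int_{dc+p-\sqrt{-1}\infty}^{dc+p+\sqrt{-1}\infty}F(s)\,ds=\frac{(-1)^p}{2\pi\sqrt{-1}}2^{d-1}\int_{c-\sqrt{-1}\infty}^{c+\sqrt{-1}\infty}G(s)\,ds.$$ (ii) There is $r>0$ such that, for all $c\in C$ and all $\zeta\in\Sigma$ with $|\zeta|<r$, the series $\varphi_p(\zeta)$ converges absolutely and $I_p(\zeta)=\varphi_p(\zeta)$. (iii) There is $R>0$ such that, for all $c\in C$ and all $\zeta\in\Sigma$ with $|\zeta|>R$, $$I_p(\zeta)=(-1)^{p+1}2^{d-1}\sum_{s_0\in S}\operatorname*{Res}_{s=s_0}G(s),$$ where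 $S$ is the set of poles of $G$ in the half plane $\operatorname{Re}s>0$ and the sum converges absolutely. Here $r$ and $R$ depend only on $d,n,p,a,\alpha$. -/

import Mathlib

noncomputable section

namespace MellinBarnes

open Complex Filter Topology

/-- The integral of `f` along the vertical line `Re s = σ`, oriented upwards:
`s = σ + i t`, `ds = i dt`. Absolute convergence is `Complex.VerticalIntegrable f σ`. -/
def verticalIntegral (f : ℂ → ℂ) (σ : ℝ) : ℂ :=
  I * ∫ t : ℝ, f (σ + t * I)

/-- The residue of `f` at `s₀`: the value of `(2πi)⁻¹ ∮ f(z) dz` over small circles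
around `s₀` (for a meromorphic `f` it is independent of the radius, once that is small). -/
def residue (f : ℂ → ℂ) (s₀ : ℂ) : ℂ :=
  limUnder (𝓝[>] (0 : ℝ)) fun r => (2 * (Real.pi : ℂ) * I)⁻¹ * ∮ z in C(s₀, r), f z

/-- The set of poles of `f` in the open right half plane. (A point where `f` is not
meromorphic has `meromorphicOrderAt` equal to `0`, so it does not count.) -/
def rightPoles (f : ℂ → ℂ) : Set ℂ :=
  {s | 0 < s.re ∧ meromorphicOrderAt f s < 0}

/-- `Γ(v) = ∏ᵢ Γ(vᵢ)` for a complex vector `v`. -/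
def gammaProd {n : ℕ} (v : Fin n → ℂ) : ℂ :=
  ∏ i, Gamma (v i)

/-- `w = e^{-πi/d} ζ`. -/
def rotate (d : ℕ) (ζ : ℂ) : ℂ :=
  exp (-((Real.pi : ℂ) / d * I)) * ζ

/-- The sector `|arg (e^{-πi/d} ζ)| < π/d` (without the origin). -/
def sector (d : ℕ) : Set ℂ :=
  {ζ | ζ ≠ 0 ∧ |(rotate d ζ).arg| < Real.pi / d}

/-- `(1 - s)_p = (1 - s)(2 - s) ⋯ (p - s)`. -/
def oneSubPoch (p : ℕ) (s : ℂ) : ℂ :=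
  ∏ j ∈ Finset.Icc 1 p, ((j : ℂ) - s)

/-- The `k`-th term `Γ(α + k a) / Γ(1 + p + d k) · ζ^{dk}` of the lacunary series. -/
def lacunaryTerm {n : ℕ} (d p : ℕ) (a : Fin n → ℕ) (α : Fin n → ℂ) (ζ : ℂ) (k : ℕ) : ℂ :=
  gammaProd (fun i => α i + (k : ℂ) * a i) / Gamma (1 + p + (d : ℂ) * k) * ζ ^ (d * k)

/-- The integrand of the first form of the Mellin–Barnes integral,
`Γ(s) ∏_{i=1}^{d-1} sin(π(s+i)/d) / (1-s)_p · Γ(α - (a/d) s) · (e^{-πi/d} ζ)^{-s}`. -/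
def integrandOne {n : ℕ} (d p : ℕ) (a : Fin n → ℕ) (α : Fin n → ℂ) (ζ s : ℂ) : ℂ :=
  Gamma s * (∏ i ∈ Finset.Ico 1 d, sin ((Real.pi : ℂ) * (s + i) / d)) / oneSubPoch p s
    * gammaProd (fun i => α i - (a i : ℂ) / d * s) * rotate d ζ ^ (-s)

/-- The integrand of the second form of the Mellin–Barnes integral,
`Γ(ds) ∏_{i=1}^{d-1} sin(π(s+(p+i)/d)) · Γ(α - (p/d) a - a s) · (e^{-πi/d} ζ)^{-ds-p}`. -/
def integrandTwo {n : ℕ} (d p : ℕ) (a : Fin n → ℕ) (α : Fin n → ℂ) (ζ s : ℂ) : ℂ :=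
  Gamma (d * s) * (∏ i ∈ Finset.Ico 1 d, sin ((Real.pi : ℂ) * (s + ((p : ℂ) + i) / d)))
    * gammaProd (fun i => α i - (p : ℂ) / d * a i - (a i : ℂ) * s)
    * rotate d ζ ^ (-((d : ℂ) * s) - p)

/-- First form of the Mellin–Barnes integral, along `Re s = σ`. -/
def integralOne {n : ℕ} (d p : ℕ) (a : Fin n → ℕ) (α : Fin n → ℂ) (ζ : ℂ) (σ : ℝ) : ℂ :=
  1 / (2 * (Real.pi : ℂ) * I) * (2 ^ (d - 1) / (d : ℂ))
    * verticalIntegral (integrandOne d p a α ζ) σ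

/-- Second form of the Mellin–Barnes integral, along `Re s = σ`. -/
def integralTwo {n : ℕ} (d p : ℕ) (a : Fin n → ℕ) (α : Fin n → ℂ) (ζ : ℂ) (σ : ℝ) : ℂ :=
  (-1) ^ p / (2 * (Real.pi : ℂ) * I) * 2 ^ (d - 1)
    * verticalIntegral (integrandTwo d p a α ζ) σ

/-- The abscissas `c > 0` such that the line `Re s = c` lies to the left of all poles of
`Γ(α - (p/d) a - a s)`: `Re(αᵢ - (p/d) aᵢ - aᵢ c) > 0` whenever `aᵢ ≠ 0`. -/
def abscissas {n : ℕ} (d p : ℕ) (a : Fin n → ℕ) (α : Fin n → ℂ) : Set ℝ :=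
  {c | 0 < c ∧ ∀ i, a i ≠ 0 → (a i : ℝ) * (c + (p : ℝ) / d) < (α i).re}

end MellinBarnes

end

noncomputable section

namespace MellinBarnes

open Complex Filter Topology

/-! On a line Re s = c with t = Im s, `Γ(ds)` and `Γ(α - (p/d)a - as)` each decay like
exp(-πd|t|/2), the second because Σ aᵢ = d. The d - 1 sines grow at most like exp(π(d-1)|t|), and
the power of w at most like exp(dθ|t|) with θ = |arg w|. The net rate is π - dθ, positive exactly on
the sector (`exists_norm_integrandTwo_le`). Hence the integral converges absolutely, and its line
may be moved across finitely many poles at the price of their residues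
(`verticalIntegral_sub_eq_sum_residue`). The two forms of the integral differ by the substitution s
↦ ds + p.

To the left lie only the poles s = -m/d of `Γ(ds)`. The sines cancel them unless m = p + dk, where
the residue is, up to a constant, the k-th term of the series; the constant comes from 2^(d-1) ∏
sin(πi/d) = d. To the right lie only poles of the other Gamma product, which may collide and have
any order, so their residues are estimated by circle integrals.

The shifted integral dies out by a functional equation. The ratio of the integrand at s + 1 and at s
is w^(-d) times a quotient of two polynomials of the same degree d in s, hence is bounded above and
below for |s| large (`norm_integrandTwo_add_one`). A unit step to the left costs at most (6|ζ|)^d,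
one to the right at most (4d/|ζ|)^d. This gives geometric decay for |ζ| < 1/6 and |ζ| > 4d
respectively (`hasSum_lacunaryTerm`, `hasSum_residue`). -/

/-! ### Local theory of residues: splitting off the singular part. -/

/-- `E` is analytic off `s₀` and differs from `r / (z - s₀)` by a function with a primitive. -/
def IsSingularPart (s₀ r : ℂ) (E : ℂ → ℂ) : Prop :=
  ∃ Q : ℂ → ℂ, ∀ z ≠ s₀, AnalyticAt ℂ E z ∧ HasDerivAt Q (E z - r / (z - s₀)) z

lemma IsSingularPart.add {s₀ r₁ r₂ : ℂ} {E₁ E₂ : ℂ → ℂ} (h₁ : IsSingularPart s₀ r₁ E₁)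
    (h₂ : IsSingularPart s₀ r₂ E₂) : IsSingularPart s₀ (r₁ + r₂) (fun z => E₁ z + E₂ z) := by
  obtain ⟨Q₁, h₁⟩ := h₁
  obtain ⟨Q₂, h₂⟩ := h₂
  refine ⟨fun z => Q₁ z + Q₂ z, fun z hz => ⟨(h₁ z hz).1.add (h₂ z hz).1, ?_⟩⟩
  refine ((h₁ z hz).2.add (h₂ z hz).2).congr_deriv ?_
  ring

lemma isSingularPart_monomial (s₀ c : ℂ) (m : ℕ) :
    ∃ r, IsSingularPart s₀ r (fun z => c * ((z - s₀) ^ (m + 1))⁻¹) := by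
  have han : ∀ z ≠ s₀, AnalyticAt ℂ (fun z => c * ((z - s₀) ^ (m + 1))⁻¹) z := by
    intro z hz
    refine analyticAt_const.mul (AnalyticAt.inv (by fun_prop) ?_)
    exact pow_ne_zero _ (sub_ne_zero.2 hz)
  rcases Nat.eq_zero_or_pos m with rfl | hm
  · refine ⟨c, fun _ => 0, fun z hz => ⟨han z hz, ?_⟩⟩
    simpa [div_eq_mul_inv] using hasDerivAt_const z (0 : ℂ)
  · refine ⟨0, fun z => -c / m * ((z - s₀) ^ m)⁻¹, fun z hz => ⟨han z hz, ?_⟩⟩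
    have hz' : z - s₀ ≠ 0 := sub_ne_zero.2 hz
    have hm' : (m : ℂ) ≠ 0 := by exact_mod_cast hm.ne'
    refine (((((hasDerivAt_id' z).sub_const s₀).fun_pow m).fun_inv
      (pow_ne_zero m hz')).const_mul (-c / m)).congr_deriv ?_
    obtain ⟨k, rfl⟩ : ∃ k, m = k + 1 := ⟨m - 1, by omega⟩
    simp
    field_simp
    ring

lemma isSingularPart_sum (s₀ : ℂ) (c : ℕ → ℂ) (n : ℕ) :
    ∃ r, IsSingularPart s₀ r (fun z => ∑ k ∈ Finset.range n, c k * ((z - s₀) ^ (k + 1))⁻¹) := by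
  induction n with
  | zero =>
    refine ⟨0, fun _ => 0, fun z _ => ⟨by simpa using analyticAt_const, ?_⟩⟩
    simpa using hasDerivAt_const z (0 : ℂ)
  | succ n ih =>
    obtain ⟨r, hr⟩ := ih
    obtain ⟨r', hr'⟩ := isSingularPart_monomial s₀ (c n) n
    exact ⟨r + r', by simpa [Finset.sum_range_succ] using hr.add hr'⟩

/-- Taylor expansion of (z - s₀)^n f to order n, divided back by (z - s₀)^n: the remainder becomes g
and the Taylor polynomial becomes E. Every power in E other than (z - s₀)⁻¹ has a primitive, so an
integral of E along a closed curve sees only r. -/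
lemma exists_singularPart {f : ℂ → ℂ} {s₀ : ℂ} (hf : MeromorphicAt f s₀) :
    ∃ g E r, AnalyticAt ℂ g s₀ ∧ IsSingularPart s₀ r E ∧ ∀ᶠ z in 𝓝[≠] s₀, f z = g z + E z := by
  obtain ⟨n, hn⟩ := hf
  have h0 : AnalyticAt ℂ (fun w => (fun z => (z - s₀) ^ n • f z) (w + s₀)) 0 := by
    have : AnalyticAt ℂ (fun z => (z - s₀) ^ n • f z) ((fun w : ℂ => w + s₀) 0) := by simpa using hn
    exact AnalyticAt.comp (f := fun w : ℂ => w + s₀) this (by fun_prop)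
  obtain ⟨F, hF, hfF⟩ := h0.exists_eq_sum_add_pow_mul n
  set D : ℕ → ℂ := fun i =>
    (1 / (i.factorial : ℂ)) * iteratedDeriv i (fun w => (fun z => (z - s₀) ^ n • f z) (w + s₀)) 0
    with hD
  obtain ⟨r, hr⟩ := isSingularPart_sum s₀ (fun k => D (n - 1 - k)) n
  refine ⟨fun z => F (z - s₀), _, r, ?_, hr, ?_⟩
  · have : AnalyticAt ℂ F ((fun z : ℂ => z - s₀) s₀) := by simpa using hF
    exact AnalyticAt.comp (f := fun z : ℂ => z - s₀) this (by fun_prop)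
  · filter_upwards [self_mem_nhdsWithin] with z hz
    have hz' : z - s₀ ≠ 0 := sub_ne_zero.2 hz
    have h1 := hfF (z - s₀)
    have h2 : ∑ k ∈ Finset.range n, D (n - 1 - k) * ((z - s₀) ^ (k + 1))⁻¹
        = ((z - s₀) ^ n)⁻¹ * ∑ i ∈ Finset.range n, (z - s₀) ^ i * D i := by
      rw [← Finset.sum_range_reflect (fun k => D (n - 1 - k) * ((z - s₀) ^ (k + 1))⁻¹),
        Finset.mul_sum]
      refine Finset.sum_congr rfl fun i hi => ?_
      have hi : i < n := Finset.mem_range.1 hi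
      have e1 : n - 1 - (n - 1 - i) = i := by omega
      have e2 : n = (n - 1 - i + 1) + i := by omega
      rw [e1]
      conv_rhs => rw [e2, pow_add]
      field_simp
    rw [h2]
    have h3 : (z - s₀) ^ n * f z
        = (∑ i ∈ Finset.range n, (z - s₀) ^ i * D i) + (z - s₀) ^ n * F (z - s₀) := by
      simp only [sub_add_cancel, smul_eq_mul] at h1
      rw [h1]
      congr 1
      refine Finset.sum_congr rfl fun i _ => ?_
      simp only [hD, smul_eq_mul]
      ring
    have h4 : f z = ((z - s₀) ^ n)⁻¹ * ((z - s₀) ^ n * f z) := by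
      field_simp
    rw [h4, h3]
    field_simp
    ring

lemma eventually_sphere {P : ℂ → Prop} {s₀ : ℂ} (h : ∀ᶠ z in 𝓝[≠] s₀, P z) :
    ∃ ρ > 0, ∀ z ∈ Metric.closedBall s₀ ρ, z ≠ s₀ → P z := by
  obtain ⟨ε, hε, h⟩ := Metric.eventually_nhds_iff_ball.1 (eventually_nhdsWithin_iff.1 h)
  exact ⟨ε / 2, by positivity, fun z hz hne =>
    h z (Metric.closedBall_subset_ball (by linarith) hz) hne⟩

/-- The circle integral is 2πi r for every small radius, so the limit defining `residue` is that of
an eventually constant function. -/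
lemma residue_eq_of_singularPart {f g E : ℂ → ℂ} {s₀ r : ℂ} (hg : AnalyticAt ℂ g s₀)
    (hE : IsSingularPart s₀ r E) (hf : ∀ᶠ z in 𝓝[≠] s₀, f z = g z + E z) :
    residue f s₀ = r := by
  obtain ⟨ρ, hρ, h1⟩ := eventually_sphere
    (hf.and (hg.eventually_analyticAt.filter_mono nhdsWithin_le_nhds))
  obtain ⟨Q, hQ⟩ := hE
  refine Tendsto.limUnder_eq (tendsto_const_nhds.congr' ?_)
  filter_upwards [Ioc_mem_nhdsGT hρ] with R hR
  have hR0 : R ≠ 0 := hR.1.ne'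
  have hsub : ∀ z ∈ Metric.sphere s₀ R, z ≠ s₀ ∧ z ∈ Metric.closedBall s₀ ρ := by
    intro z hz
    exact ⟨Metric.ne_of_mem_sphere hz hR0,
      Metric.closedBall_subset_closedBall hR.2 (Metric.sphere_subset_closedBall hz)⟩
  have hgd : DifferentiableOn ℂ g (Metric.closedBall s₀ R) := by
    intro z hz
    rcases eq_or_ne z s₀ with rfl | hne
    · exact hg.differentiableAt.differentiableWithinAt
    · exact (h1 z (Metric.closedBall_subset_closedBall hR.2 hz) hne).2.differentiableAt.differentiableWithinAt
  have hcg : CircleIntegrable g s₀ R :=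
    (hgd.continuousOn.mono Metric.sphere_subset_closedBall).circleIntegrable hR.1.le
  have hcE : ContinuousOn E (Metric.sphere s₀ R) := fun z hz =>
    (hQ z (hsub z hz).1).1.continuousAt.continuousWithinAt
  have hci : ContinuousOn (fun z => r / (z - s₀)) (Metric.sphere s₀ R) := by
    refine continuousOn_const.div (by fun_prop) fun z hz => sub_ne_zero.2 (hsub z hz).1
  have e1 : (∮ z in C(s₀, R), f z) =
      ∮ z in C(s₀, R), (g z + ((E z - r / (z - s₀)) + r / (z - s₀))) := by
    refine circleIntegral.integral_congr hR.1.le fun z hz => ?_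
    have := (h1 z (hsub z hz).2 (hsub z hz).1).1
    simp [this]
  have c1 := (hcE.fun_sub hci).circleIntegrable hR.1.le
  have c2 := hci.circleIntegrable hR.1.le
  have e2 : (∮ z in C(s₀, R), g z) = 0 := by
    refine circleIntegral_eq_zero_of_differentiable_on_off_countable hR.1.le
      Set.countable_empty hgd.continuousOn fun z hz => ?_
    exact hgd.differentiableAt (mem_of_superset (Metric.isOpen_ball.mem_nhds hz.1)
      Metric.ball_subset_closedBall)
  have e3 : (∮ z in C(s₀, R), (E z - r / (z - s₀))) = 0 :=
    circleIntegral.integral_eq_zero_of_hasDerivWithinAt hR.1.le fun z hz =>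
      (hQ z (hsub z hz).1).2.hasDerivWithinAt
  have e4 : (∮ z in C(s₀, R), r / (z - s₀)) = r * (2 * Real.pi * I) := by
    simp_rw [div_eq_mul_inv]
    rw [circleIntegral.integral_const_mul, circleIntegral.integral_sub_center_inv _ hR0]
  rw [e1, circleIntegral.integral_add hcg (c1.fun_add c2), circleIntegral.integral_add c1 c2, e2, e3, e4]
  have : (Real.pi : ℂ) ≠ 0 := by exact_mod_cast Real.pi_ne_zero
  field_simp
  simp

/-! ### Rectangle integrals and the residue theorem. -/

/-- Integral over the boundary of the rectangle `[a, b] × [c, d]`, counterclockwise. -/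
def rectIntegral (f : ℂ → ℂ) (a b c d : ℝ) : ℂ :=
  (∫ x : ℝ in a..b, f (x + c * I)) - (∫ x : ℝ in a..b, f (x + d * I)) +
    I * (∫ y : ℝ in c..d, f (b + y * I)) - I * (∫ y : ℝ in c..d, f (a + y * I))

/-- The boundary of the rectangle `[a, b] × [c, d]`. -/
def rectBoundary (a b c d : ℝ) : Set ℂ :=
  {z | (z.re ∈ Set.Icc a b ∧ (z.im = c ∨ z.im = d)) ∨ (z.im ∈ Set.Icc c d ∧ (z.re = a ∨ z.re = b))}

section rect
variable {a b c d : ℝ}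

lemma rect_sides_integrable (hab : a ≤ b) (hcd : c ≤ d) {f : ℂ → ℂ}
    (hf : ContinuousOn f (rectBoundary a b c d)) :
    (IntervalIntegrable (fun x : ℝ => f (x + c * I)) MeasureTheory.volume a b ∧
    IntervalIntegrable (fun x : ℝ => f (x + d * I)) MeasureTheory.volume a b) ∧
    IntervalIntegrable (fun y : ℝ => f (b + y * I)) MeasureTheory.volume c d ∧
    IntervalIntegrable (fun y : ℝ => f (a + y * I)) MeasureTheory.volume c d := by
  refine ⟨⟨?_, ?_⟩, ?_, ?_⟩ <;>
  · apply ContinuousOn.intervalIntegrable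
    refine hf.comp (by fun_prop) fun x hx => ?_
    first | rw [Set.uIcc_of_le hab] at hx | rw [Set.uIcc_of_le hcd] at hx
    simp_all [rectBoundary]

lemma rectIntegral_add (hab : a ≤ b) (hcd : c ≤ d) {f g : ℂ → ℂ}
    (hf : ContinuousOn f (rectBoundary a b c d)) (hg : ContinuousOn g (rectBoundary a b c d)) :
    rectIntegral (fun z => f z + g z) a b c d = rectIntegral f a b c d + rectIntegral g a b c d := by
  obtain ⟨⟨f1, f2⟩, f3, f4⟩ := rect_sides_integrable hab hcd hf
  obtain ⟨⟨g1, g2⟩, g3, g4⟩ := rect_sides_integrable hab hcd hg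
  simp only [rectIntegral]
  rw [intervalIntegral.integral_add f1 g1, intervalIntegral.integral_add f2 g2,
    intervalIntegral.integral_add f3 g3, intervalIntegral.integral_add f4 g4]
  ring

lemma rectIntegral_congr (hab : a ≤ b) (hcd : c ≤ d) {f g : ℂ → ℂ}
    (h : ∀ z ∈ rectBoundary a b c d, f z = g z) :
    rectIntegral f a b c d = rectIntegral g a b c d := by
  unfold rectIntegral
  congr 1
  · congr 1
    · congr 1 <;>
      · refine intervalIntegral.integral_congr fun x hx => h _ ?_
        rw [Set.uIcc_of_le hab] at hx
        simp_all [rectBoundary]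
    · congr 1
      refine intervalIntegral.integral_congr fun x hx => h _ ?_
      rw [Set.uIcc_of_le hcd] at hx
      simp_all [rectBoundary]
  · congr 1
    refine intervalIntegral.integral_congr fun x hx => h _ ?_
    rw [Set.uIcc_of_le hcd] at hx
    simp_all [rectBoundary]

lemma integral_horizontal {F f : ℂ → ℂ} (hab : a ≤ b)
    (h : ∀ x ∈ Set.Icc a b, HasDerivAt F (f (x + c * I)) (x + c * I))
    (hc : IntervalIntegrable (fun x : ℝ => f (x + c * I)) MeasureTheory.volume a b) :
    ∫ x : ℝ in a..b, f (x + c * I) = F (b + c * I) - F (a + c * I) := by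
  refine intervalIntegral.integral_eq_sub_of_hasDerivAt (f := fun x : ℝ => F (x + c * I))
    (fun x hx => ?_) hc
  rw [Set.uIcc_of_le hab] at hx
  have h1 : HasDerivAt (fun z : ℂ => F (z + c * I)) (f (x + c * I)) (x : ℂ) :=
    (h x hx).comp_add_const (x : ℂ) (c * I)
  exact h1.comp_ofReal

lemma integral_vertical {F f : ℂ → ℂ} (hcd : c ≤ d)
    (h : ∀ y ∈ Set.Icc c d, HasDerivAt F (f (a + y * I)) (a + y * I))
    (hc : IntervalIntegrable (fun y : ℝ => f (a + y * I)) MeasureTheory.volume c d) :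
    I * ∫ y : ℝ in c..d, f (a + y * I) = F (a + d * I) - F (a + c * I) := by
  rw [← intervalIntegral.integral_const_mul]
  refine intervalIntegral.integral_eq_sub_of_hasDerivAt (f := fun y : ℝ => F (a + y * I))
    (fun y hy => ?_) (hc.const_mul I)
  rw [Set.uIcc_of_le hcd] at hy
  have h0 : HasDerivAt (fun z : ℂ => (a : ℂ) + z * I) I (y : ℂ) := by
    simpa using ((hasDerivAt_id (y : ℂ)).mul_const I).const_add (a : ℂ)
  have h1 : HasDerivAt (fun z : ℂ => F (a + z * I)) (f (a + y * I) * I) (y : ℂ) :=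
    (h y hy).comp (y : ℂ) h0
  rw [mul_comm]
  exact h1.comp_ofReal

end rect

section rect
variable {a b c d : ℝ}

/-- The jump between the two branches of the logarithm used in `rectIntegral_inv`. -/
lemma log_sub_log_neg_of_im_pos {z : ℂ} (hz : 0 < z.im) : log z - log (-z) = Real.pi * I := by
  simp only [log, norm_neg, arg_neg_eq_arg_sub_pi_of_im_pos hz]
  push_cast
  ring

lemma rectIntegral_inv {s₀ : ℂ} (ha : a < s₀.re) (hb : s₀.re < b) (hc : c < s₀.im)
    (hd : s₀.im < d) : rectIntegral (fun z => (z - s₀)⁻¹) a b c d = 2 * Real.pi * I := by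
  have hab : a ≤ b := by linarith
  have hcd : c ≤ d := by linarith
  have hcont : ContinuousOn (fun z => (z - s₀)⁻¹) (rectBoundary a b c d) := by
    refine ContinuousOn.inv₀ (by fun_prop) fun z hz h => ?_
    rw [sub_eq_zero] at h
    subst h
    rcases hz with ⟨_, h | h⟩ | ⟨_, h | h⟩ <;> linarith
  obtain ⟨⟨i1, i2⟩, i3, i4⟩ := rect_sides_integrable hab hcd hcont
  have hlog : ∀ z : ℂ, z - s₀ ∈ slitPlane →
      HasDerivAt (fun z => log (z - s₀)) ((z - s₀)⁻¹) z := fun z hz => by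
    simpa using ((hasDerivAt_id z).sub_const s₀).clog hz
  have hlog' : ∀ z : ℂ, -(z - s₀) ∈ slitPlane →
      HasDerivAt (fun z => log (-(z - s₀))) ((z - s₀)⁻¹) z := fun z hz => by
    have hz' : z - s₀ ≠ 0 := neg_ne_zero.1 (slitPlane_ne_zero hz)
    refine (((hasDerivAt_id' z).sub_const s₀).fun_neg.clog hz).congr_deriv ?_
    field_simp
  unfold rectIntegral
  -- The principal branch serves on three sides and log(-(z - s₀)) on the left side, which meets the
  -- cut. The branches disagree at the two left corners, and each corner contributes πi.
  rw [integral_horizontal hab (F := fun z => log (z - s₀)) (f := fun z => (z - s₀)⁻¹)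
      (fun x _ => hlog _ ?_) i1,
    integral_horizontal hab (F := fun z => log (z - s₀)) (f := fun z => (z - s₀)⁻¹)
      (fun x _ => hlog _ ?_) i2,
    integral_vertical hcd (F := fun z => log (z - s₀)) (f := fun z => (z - s₀)⁻¹)
      (fun x _ => hlog _ ?_) i3,
    integral_vertical hcd (F := fun z => log (-(z - s₀)))
      (f := fun z => (z - s₀)⁻¹) (fun x _ => hlog' _ ?_) i4]
  · have h1 := log_sub_log_neg_of_im_pos (z := a + d * I - s₀) (by simpa using hd)
    have h2 := log_sub_log_neg_of_im_pos (z := -(a + c * I - s₀)) (by simpa using hc)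
    rw [neg_neg] at h2
    linear_combination h1 + h2
  all_goals
    rw [mem_slitPlane_iff]
    simp only [neg_re, neg_im, sub_re, sub_im, add_re, add_im, ofReal_re, ofReal_im, mul_re,
      mul_im, I_re, I_im, mul_zero, mul_one, sub_zero, add_zero, zero_add]
    first
    | (left; linarith)
    | (right; intro h; linarith)

lemma rectIntegral_eq_zero_of_hasDerivAt {F f : ℂ → ℂ} (hab : a ≤ b) (hcd : c ≤ d)
    (h : ∀ z ∈ rectBoundary a b c d, HasDerivAt F (f z) z)
    (hf : ContinuousOn f (rectBoundary a b c d)) : rectIntegral f a b c d = 0 := by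
  obtain ⟨⟨i1, i2⟩, i3, i4⟩ := rect_sides_integrable hab hcd hf
  unfold rectIntegral
  rw [integral_horizontal hab (F := F) (fun x hx => h _ ?_) i1,
    integral_horizontal hab (F := F) (fun x hx => h _ ?_) i2,
    integral_vertical hcd (F := F) (fun x hx => h _ ?_) i3,
    integral_vertical hcd (F := F) (fun x hx => h _ ?_) i4]
  · ring
  all_goals simp_all [rectBoundary]

lemma rectIntegral_singularPart {s₀ r : ℂ} {E : ℂ → ℂ} (hE : IsSingularPart s₀ r E)
    (ha : a < s₀.re) (hb : s₀.re < b) (hc : c < s₀.im) (hd : s₀.im < d) :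
    rectIntegral E a b c d = 2 * Real.pi * I * r := by
  have hab : a ≤ b := by linarith
  have hcd : c ≤ d := by linarith
  obtain ⟨Q, hQ⟩ := hE
  have hne : ∀ z ∈ rectBoundary a b c d, z ≠ s₀ := by
    rintro z hz rfl
    rcases hz with ⟨_, h | h⟩ | ⟨_, h | h⟩ <;> linarith
  have hcE : ContinuousOn E (rectBoundary a b c d) := fun z hz =>
    (hQ z (hne z hz)).1.continuousAt.continuousWithinAt
  have hci : ContinuousOn (fun z => r / (z - s₀)) (rectBoundary a b c d) :=
    continuousOn_const.div (by fun_prop) fun z hz => sub_ne_zero.2 (hne z hz)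
  have e0 : rectIntegral E a b c d =
      rectIntegral (fun z => (E z - r / (z - s₀)) + r / (z - s₀)) a b c d :=
    rectIntegral_congr hab hcd fun z _ => by ring
  have e1 : rectIntegral (fun z => r / (z - s₀)) a b c d =
      r * rectIntegral (fun z => (z - s₀)⁻¹) a b c d := by
    simp only [rectIntegral, div_eq_mul_inv, intervalIntegral.integral_const_mul]
    ring
  rw [e0, rectIntegral_add hab hcd (hcE.fun_sub hci) hci, e1, rectIntegral_inv ha hb hc hd,
    rectIntegral_eq_zero_of_hasDerivAt hab hcd (fun z hz => (hQ z (hne z hz)).2) (hcE.fun_sub hci)]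
  ring

lemma residue_sub_analyticAt {f E : ℂ → ℂ} {s : ℂ} (hf : MeromorphicAt f s)
    (hE : AnalyticAt ℂ E s) : residue (fun z => f z - E z) s = residue f s := by
  obtain ⟨g, E', r, hg, hE', h⟩ := exists_singularPart hf
  rw [residue_eq_of_singularPart hg hE' h]
  refine residue_eq_of_singularPart (hg.sub hE) hE' ?_
  filter_upwards [h] with z hz
  simp [hz]
  ring

lemma residue_congr {f g : ℂ → ℂ} {s : ℂ} (hf : MeromorphicAt f s) (h : f =ᶠ[𝓝[≠] s] g) :
    residue g s = residue f s := by
  obtain ⟨g', E', r, hg, hE', h'⟩ := exists_singularPart hf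
  rw [residue_eq_of_singularPart hg hE' h']
  refine residue_eq_of_singularPart hg hE' ?_
  filter_upwards [h, h'] with z h1 h2
  rw [← h1, h2]

/-- The residue theorem for a rectangle. -/
theorem rectIntegral_eq_sum_residue (hab : a ≤ b) (hcd : c ≤ d) (S : Finset ℂ) :
    ∀ f : ℂ → ℂ, (∀ z, z.re ∈ Set.Icc a b → z.im ∈ Set.Icc c d → z ∉ S → AnalyticAt ℂ f z) →
    (∀ s ∈ S, MeromorphicAt f s) →
    (∀ s ∈ S, s.re ∈ Set.Ioo a b ∧ s.im ∈ Set.Ioo c d) →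
    rectIntegral f a b c d = 2 * Real.pi * I * ∑ s ∈ S, residue f s := by
  classical
  induction S using Finset.induction_on with
  | empty =>
    intro f hf _ _
    have h := integral_boundary_rect_eq_zero_of_differentiableOn f (a + c * I) (b + d * I)
      (fun z hz => by
        simp [Complex.reProdIm, Set.uIcc_of_le hab, Set.uIcc_of_le hcd] at hz
        exact (hf z hz.1 hz.2 (by simp)).differentiableAt.differentiableWithinAt)
    simp only [add_re, ofReal_re, mul_re, I_re, mul_zero, ofReal_im, I_im, mul_one, sub_self,
      add_zero, add_im, mul_im, zero_add, smul_eq_mul] at h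
    simpa [rectIntegral] using h
  | insert s₀ S hs ih =>
    intro f hf hm hS
    obtain ⟨g, E, r, hg, hE, h⟩ := exists_singularPart (hm s₀ (by simp))
    have hbd : ∀ z ∈ rectBoundary a b c d, (z.re ∈ Set.Icc a b ∧ z.im ∈ Set.Icc c d) ∧
        z ∉ insert s₀ S := by
      intro z hz
      constructor
      · rcases hz with ⟨h1, h2 | h2⟩ | ⟨h1, h2 | h2⟩ <;> simp_all
      · intro hz'
        obtain ⟨h1, h2⟩ := hS z hz'
        rcases hz with ⟨_, h | h⟩ | ⟨_, h | h⟩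
        · exact h2.1.ne' h
        · exact h2.2.ne h
        · exact h1.1.ne' h
        · exact h1.2.ne h
    obtain ⟨Q, hQ⟩ := id hE
    -- Removing the singular part at s₀ leaves a function with singularities in S only, to which the
    -- induction hypothesis applies. The value at s₀ itself is arbitrary and has to be corrected.
    set f₁ : ℂ → ℂ := Function.update (fun z => f z - E z) s₀ (g s₀) with hf₁
    have hf₁' : ∀ z ≠ s₀, (fun z => f z - E z) =ᶠ[𝓝 z] f₁ := fun z hz => by
      filter_upwards [isOpen_ne.mem_nhds hz] with w hw
      simp [hf₁, Function.update_of_ne hw]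
    have han : AnalyticAt ℂ f₁ s₀ := by
      refine hg.congr ?_
      filter_upwards [eventually_nhdsWithin_iff.1 h] with z hz
      rcases eq_or_ne z s₀ with rfl | hne
      · simp [hf₁]
      · simp [hf₁, Function.update_of_ne hne, hz hne]
    have hne : ∀ s ∈ S, s ≠ s₀ := fun s hs' => fun h => hs (h ▸ hs')
    have hr : ∀ s ∈ S, residue f₁ s = residue f s := fun s hs' => by
      have hms := hm s (Finset.mem_insert_of_mem hs')
      rw [← residue_sub_analyticAt hms (hQ s (hne s hs')).1]
      exact residue_congr (hms.sub (hQ s (hne s hs')).1.meromorphicAt)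
        ((hf₁' s (hne s hs')).filter_mono nhdsWithin_le_nhds)
    have h1 := ih f₁ (fun z h1 h2 h3 => by
      rcases eq_or_ne z s₀ with rfl | hz
      · exact han
      · exact ((hf z h1 h2 (by simp [hz, h3])).sub (hQ z hz).1).congr (hf₁' z hz))
      (fun s hs' => ((hm s (Finset.mem_insert_of_mem hs')).sub
        (hQ s (hne s hs')).1.meromorphicAt).congr
          ((hf₁' s (hne s hs')).filter_mono nhdsWithin_le_nhds))
      (fun s hs' => hS s (Finset.mem_insert_of_mem hs'))
    have hz0 : ∀ z ∈ rectBoundary a b c d, z ≠ s₀ := fun z hz h =>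
      (hbd z hz).2 (h ▸ Finset.mem_insert_self _ _)
    have e1 : rectIntegral f a b c d = rectIntegral (fun z => f₁ z + E z) a b c d := by
      refine rectIntegral_congr hab hcd fun z hz => ?_
      simp [hf₁, Function.update_of_ne (hz0 z hz)]
    have hcE : ContinuousOn E (rectBoundary a b c d) := fun z hz =>
      (hQ z (hz0 z hz)).1.continuousAt.continuousWithinAt
    have hcf : ContinuousOn f₁ (rectBoundary a b c d) := fun z hz => by
      have h2 := hbd z hz
      exact (((hf z h2.1.1 h2.1.2 h2.2).sub (hQ z (hz0 z hz)).1).congr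
        (hf₁' z (hz0 z hz))).continuousAt.continuousWithinAt
    have hs0 := hS s₀ (by simp)
    rw [e1, rectIntegral_add hab hcd hcf hcE, h1, rectIntegral_singularPart hE hs0.1.1 hs0.1.2
      hs0.2.1 hs0.2.2, Finset.sum_insert hs, residue_eq_of_singularPart hg hE h,
      Finset.sum_congr rfl hr]
    ring

end rect

/-! ### Vertical lines: integrability and shifting under exponential decay. -/

lemma integrable_exp_neg_mul_abs {ε : ℝ} (hε : 0 < ε) :
    MeasureTheory.Integrable (fun t : ℝ => Real.exp (-ε * |t|)) := by
  have hc : Continuous (fun t : ℝ => Real.exp (-ε * |t|)) := by fun_prop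
  refine hc.locallyIntegrable.integrable_of_isBigO_atTop_of_norm_isNegInvariant
    (g := fun t : ℝ => Real.exp (-ε * t)) (Eventually.of_forall fun t => by simp) ?_
    ⟨Set.Ioi 0, Ioi_mem_atTop 0, integrableOn_exp_mul_Ioi (by linarith) 0⟩
  refine Asymptotics.IsBigO.of_bound 1 ?_
  filter_upwards [eventually_ge_atTop 0] with t ht
  simp [abs_of_nonneg ht]

lemma verticalIntegrable_of_decay {f : ℂ → ℂ} {σ C ε T : ℝ} (hε : 0 < ε)
    (hf : ∀ z : ℂ, z.re = σ → AnalyticAt ℂ f z)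
    (hd : ∀ z : ℂ, z.re = σ → T ≤ |z.im| → ‖f z‖ ≤ C * Real.exp (-ε * |z.im|)) :
    VerticalIntegrable f σ := by
  have hc : Continuous (fun t : ℝ => f (σ + t * I)) := by
    rw [continuous_iff_continuousAt]
    intro t
    have := (hf (σ + t * I) (by simp)).continuousAt
    exact ContinuousAt.comp (f := fun t : ℝ => (σ : ℂ) + t * I) this (by fun_prop)
  have hloc : MeasureTheory.LocallyIntegrable (fun t : ℝ => f (σ + t * I)) := hc.locallyIntegrable
  have hO : ∀ l : Filter ℝ, (∀ᶠ t in l, T ≤ |t|) →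
      (fun t : ℝ => f (σ + t * I)) =O[l] (fun t : ℝ => Real.exp (-ε * |t|)) := fun l hl => by
    refine Asymptotics.IsBigO.of_bound C ?_
    filter_upwards [hl] with t ht
    have := hd (σ + t * I) (by simp) (by simpa using ht)
    simpa [abs_of_pos (Real.exp_pos _)] using this
  have hi := integrable_exp_neg_mul_abs hε
  exact hloc.integrable_of_isBigO_atBot_atTop
    (hO _ (tendsto_abs_atBot_atTop.eventually_ge_atTop T)) (hi.integrableAtFilter _)
    (hO _ (tendsto_abs_atTop_atTop.eventually_ge_atTop T)) (hi.integrableAtFilter _)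

/-- Shifting a vertical line of integration across finitely many poles. -/
theorem verticalIntegral_sub_eq_sum_residue {f : ℂ → ℂ} {a b C ε T : ℝ} (hab : a < b) (hε : 0 < ε)
    (S : Finset ℂ) (hS : ∀ s ∈ S, s.re ∈ Set.Ioo a b) (hm : ∀ s ∈ S, MeromorphicAt f s)
    (hf : ∀ z : ℂ, z.re ∈ Set.Icc a b → z ∉ S → AnalyticAt ℂ f z)
    (hd : ∀ z : ℂ, z.re ∈ Set.Icc a b → T ≤ |z.im| → ‖f z‖ ≤ C * Real.exp (-ε * |z.im|)) :
    verticalIntegral f b - verticalIntegral f a = 2 * Real.pi * I * ∑ s ∈ S, residue f s := by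
  have hia : VerticalIntegrable f a := verticalIntegrable_of_decay (C := C) (T := T) hε
    (fun z hz => hf z (by simp [hz, hab.le]) fun h => (hS z h).1.ne' hz)
    (fun z hz => hd z (by simp [hz, hab.le]))
  have hib : VerticalIntegrable f b := verticalIntegrable_of_decay (C := C) (T := T) hε
    (fun z hz => hf z (by simp [hz, hab.le]) fun h => (hS z h).2.ne hz)
    (fun z hz => hd z (by simp [hz, hab.le]))
  have lim : ∀ {σ : ℝ}, VerticalIntegrable f σ →
      Tendsto (fun n : ℕ => I * ∫ y in (-(n : ℝ))..n, f (σ + y * I)) atTop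
        (𝓝 (verticalIntegral f σ)) := fun {σ} h => by
    exact (MeasureTheory.intervalIntegral_tendsto_integral h
      (tendsto_neg_atTop_atBot.comp tendsto_natCast_atTop_atTop)
      tendsto_natCast_atTop_atTop).const_mul I
  have hdec : Tendsto (fun n : ℕ => C * Real.exp (-ε * n) * |b - a|) atTop (𝓝 0) := by
    have h1 : Tendsto (fun n : ℕ => Real.exp (-(ε * (n : ℝ)))) atTop (𝓝 0) :=
      Real.tendsto_exp_neg_atTop_nhds_zero.comp
        (tendsto_natCast_atTop_atTop.const_mul_atTop hε)
    simpa using (h1.const_mul C).mul_const |b - a|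
  -- The horizontal sides at heights ±n vanish in the limit.
  have hor : ∀ τ : ℕ → ℝ, (∀ n, |τ n| = n) →
      Tendsto (fun n : ℕ => ∫ x in a..b, f (x + τ n * I)) atTop (𝓝 0) := fun τ hτ => by
    refine squeeze_zero_norm' ?_ hdec
    filter_upwards [tendsto_natCast_atTop_atTop.eventually_ge_atTop T] with n hn
    refine intervalIntegral.norm_integral_le_of_norm_le_const fun x hx => ?_
    rw [Set.uIoc_of_le hab.le] at hx
    have := hd (x + τ n * I) (by simpa using ⟨hx.1.le, hx.2⟩) (by simpa [hτ] using hn)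
    simpa [hτ] using this
  have hrect : Tendsto (fun n : ℕ => rectIntegral f a b (-(n : ℝ)) n) atTop
      (𝓝 (verticalIntegral f b - verticalIntegral f a)) := by
    have h1 := hor (fun n => -(n : ℝ)) (fun n => by simp)
    have h2 := hor (fun n => (n : ℝ)) (fun n => by simp)
    have := ((h1.sub h2).add (lim hib)).sub (lim hia)
    simpa [rectIntegral] using this
  refine tendsto_nhds_unique hrect (tendsto_const_nhds.congr' ?_)
  have hbig : ∀ᶠ n : ℕ in atTop, ∀ s ∈ S, |s.im| < n := by
    rw [Finset.eventually_all]
    exact fun s _ => tendsto_natCast_atTop_atTop.eventually_gt_atTop |s.im|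
  filter_upwards [hbig] with n hn
  refine (rectIntegral_eq_sum_residue hab.le (by have : (0:ℝ) ≤ n := by positivity
                                                 linarith) S f
    (fun z h _ h3 => hf z h h3) hm fun s hs => ⟨hS s hs, ?_⟩).symm
  exact abs_lt.1 (hn s hs)

/-! ### Exponential decay of the Gamma function in vertical strips. -/

/-- The modulus of x^(u-1) (1-x)^(v-1) on (0,1) depends only on the real parts. Through B(z,a) =
Γ(z)Γ(a)/Γ(z+a) this compares |Γ| at two points of the same height without Stirling's formula. -/
lemma norm_betaIntegral_le (u v : ℂ) :
    ‖betaIntegral u v‖ ≤ ‖betaIntegral (u.re : ℂ) (v.re : ℂ)‖ := by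
  have key : ∀ x ∈ Set.Ioo (0 : ℝ) 1, ∀ a b : ℂ,
      ‖(x : ℂ) ^ (a - 1) * (1 - (x : ℂ)) ^ (b - 1)‖ = x ^ (a.re - 1) * (1 - x) ^ (b.re - 1) := by
    intro x hx a b
    rw [norm_mul, ← ofReal_one, ← ofReal_sub, norm_cpow_eq_rpow_re_of_pos hx.1,
      norm_cpow_eq_rpow_re_of_pos (by linarith [hx.2])]
    simp
  have h1 : ‖betaIntegral u v‖ ≤
      ∫ x : ℝ in 0..1, ‖(x : ℂ) ^ (u - 1) * (1 - (x : ℂ)) ^ (v - 1)‖ :=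
    intervalIntegral.norm_integral_le_integral_norm zero_le_one
  have h2 : betaIntegral (u.re : ℂ) (v.re : ℂ) =
      ((∫ x : ℝ in 0..1, ‖(x : ℂ) ^ (u - 1) * (1 - (x : ℂ)) ^ (v - 1)‖ : ℝ) : ℂ) := by
    rw [← intervalIntegral.integral_ofReal]
    unfold betaIntegral
    rw [intervalIntegral.integral_of_le zero_le_one, intervalIntegral.integral_of_le zero_le_one,
      MeasureTheory.integral_Ioc_eq_integral_Ioo, MeasureTheory.integral_Ioc_eq_integral_Ioo]
    refine MeasureTheory.setIntegral_congr_fun measurableSet_Ioo fun x hx => ?_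
    rw [key x hx, ofReal_mul, ofReal_cpow hx.1.le, ofReal_cpow (by linarith [hx.2])]
    push_cast
    rfl
  rw [h2, norm_real]
  exact h1.trans (le_abs_self _)

/-- `‖Γ(x + iy)‖ / Γ(x)` is nondecreasing in `x > 0`. -/
lemma norm_Gamma_le_mul_norm_Gamma_add {z : ℂ} {a : ℝ} (hz : 0 < z.re) (ha : 0 < a) :
    ‖Gamma z‖ ≤ Real.Gamma z.re / Real.Gamma (z.re + a) * ‖Gamma (z + a)‖ := by
  have h := norm_betaIntegral_le z a
  rw [betaIntegral_eq_Gamma_mul_div _ _ hz (by simpa using ha),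
    betaIntegral_eq_Gamma_mul_div _ _ (by simpa using hz) (by simpa using ha)] at h
  rw [ofReal_re, ← ofReal_add, Gamma_ofReal, Gamma_ofReal, Gamma_ofReal, norm_div, norm_div,
    norm_mul, norm_mul] at h
  simp only [norm_real, Real.norm_eq_abs] at h
  have g1 := Real.Gamma_pos_of_pos hz
  have g2 := Real.Gamma_pos_of_pos ha
  have g3 := Real.Gamma_pos_of_pos (add_pos hz ha)
  rw [abs_of_pos g1, abs_of_pos g2, abs_of_pos g3] at h
  have g4 : 0 < ‖Gamma (z + a)‖ := norm_pos_iff.2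
    (Gamma_ne_zero_of_re_pos (by simpa using add_pos hz ha))
  rw [div_le_div_iff₀ g4 g3] at h
  rw [div_mul_eq_mul_div, le_div_iff₀ g3]
  nlinarith

/-- The reflection formula gives |Γ(1+iy)|² = π|y| / sinh(π|y|). The hypothesis on y yields
sinh(π|y|) ≥ exp(π|y|)/4 and |y| ≤ |y|². -/
lemma norm_Gamma_one_add_mul_I_le {y : ℝ} (hy : 1 ≤ |y|) :
    ‖Gamma (1 + y * I)‖ ≤ 4 * |y| * Real.exp (-(Real.pi / 2) * |y|) := by
  have hy0 : y ≠ 0 := by rintro rfl; norm_num at hy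
  have hyI : (y : ℂ) * I ≠ 0 := mul_ne_zero (by exact_mod_cast hy0) I_ne_zero
  have h1 : Gamma (1 + y * I) * Gamma (1 - y * I) = y * I * (Real.pi / sin (Real.pi * (y * I))) := by
    rw [← Gamma_mul_Gamma_one_sub, add_comm, Gamma_add_one _ hyI]
    ring
  have h2 : ‖Gamma (1 - y * I)‖ = ‖Gamma (1 + y * I)‖ := by
    rw [← norm_conj, ← Gamma_conj]
    congr 2
    simp
  have h3 : ‖sin (Real.pi * (y * I))‖ = Real.sinh (Real.pi * |y|) := by
    rw [← mul_assoc, sin_mul_I, norm_mul, norm_I, mul_one, ← ofReal_mul, ← ofReal_sinh, norm_real,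
      Real.norm_eq_abs, Real.abs_sinh, abs_mul, abs_of_pos Real.pi_pos]
  have h4 : Real.exp (Real.pi * |y|) / 4 ≤ Real.sinh (Real.pi * |y|) := by
    rw [Real.sinh_eq]
    have a1 : 1 + 1 ≤ Real.exp (Real.pi * |y|) := by
      have := Real.add_one_le_exp (Real.pi * |y|)
      nlinarith [Real.pi_gt_three]
    have a2 : Real.exp (-(Real.pi * |y|)) ≤ 1 := Real.exp_le_one_iff.2 (by
      have := Real.pi_pos; have := abs_nonneg y; nlinarith)
    linarith
  have h5 : ‖Gamma (1 + y * I)‖ ^ 2 ≤ (4 * |y| * Real.exp (-(Real.pi / 2) * |y|)) ^ 2 := by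
    have e1 : ‖Gamma (1 + y * I)‖ ^ 2 = |y| * (Real.pi / Real.sinh (Real.pi * |y|)) := by
      have := congrArg norm h1
      rw [norm_mul, h2, norm_mul, norm_div, h3] at this
      rw [sq, this]
      simp [abs_of_pos Real.pi_pos]
    have e2 : (Real.exp (-(Real.pi / 2) * |y|)) ^ 2 = (Real.exp (Real.pi * |y|))⁻¹ := by
      rw [← Real.exp_nat_mul, ← Real.exp_neg]
      congr 1
      push_cast
      ring
    rw [e1, mul_pow, e2]
    have hE := Real.exp_pos (Real.pi * |y|)
    have e3 : Real.pi / Real.sinh (Real.pi * |y|) ≤ 4 * 4 * (Real.exp (Real.pi * |y|))⁻¹ := by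
      rw [div_le_iff₀ (by linarith)]
      have : 4 * 4 * (Real.exp (Real.pi * |y|))⁻¹ * (Real.exp (Real.pi * |y|) / 4) = 4 := by
        field_simp
      have h6 := mul_le_mul_of_nonneg_left h4
        (show 0 ≤ 4 * 4 * (Real.exp (Real.pi * |y|))⁻¹ by positivity)
      linarith [Real.pi_le_four]
    calc |y| * (Real.pi / Real.sinh (Real.pi * |y|))
        ≤ |y| * (4 * 4 * (Real.exp (Real.pi * |y|))⁻¹) := by gcongr
      _ ≤ |y| * |y| * (4 * 4 * (Real.exp (Real.pi * |y|))⁻¹) := by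
          have : |y| ≤ |y| * |y| := by nlinarith
          gcongr
      _ = _ := by ring
  exact (pow_le_pow_iff_left₀ (norm_nonneg _) (by positivity) two_ne_zero).1 h5

lemma mul_exp_le {δ y : ℝ} (hδ : 0 < δ) : y ≤ 1 / δ * Real.exp (δ * y) := by
  have := Real.add_one_le_exp (δ * y)
  rw [div_mul_eq_mul_div, le_div_iff₀ hδ]
  linarith

lemma exists_norm_Gamma_le_base {δ : ℝ} (hδ : 0 < δ) : ∃ C, ∀ z : ℂ, 1 ≤ z.re → z.re < 2 →
    1 ≤ |z.im| → ‖Gamma z‖ ≤ C * Real.exp (-(Real.pi / 2 - δ) * |z.im|) := by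
  obtain ⟨B, hB⟩ := isCompact_Icc.exists_bound_of_continuousOn
    (f := Real.Gamma) (s := Set.Icc 1 2) (fun x hx =>
      (Real.differentiableAt_Gamma (fun m => by
        have h1 := hx.1
        have : (0 : ℝ) ≤ m := m.cast_nonneg
        linarith)).continuousAt.continuousWithinAt)
  refine ⟨B * (8 * (1 / (δ / 2)) ^ 2), fun z h1 h2 hy => ?_⟩
  -- Moving right to the line Re = 2, where Γ(2+iy) = (1+iy)Γ(1+iy). The resulting factor |y|² is
  -- absorbed by two copies of exp(δ|y|/2).
  have e0 := norm_Gamma_le_mul_norm_Gamma_add (z := z) (a := 2 - z.re) (by linarith) (by linarith)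
  have e1 : z + ((2 - z.re : ℝ) : ℂ) = (1 + z.im * I) + 1 := by
    apply Complex.ext <;> simp
    norm_num
  have hne : 1 + (z.im : ℂ) * I ≠ 0 := fun h => by
    have := congrArg Complex.re h
    simp at this
  rw [e1, Gamma_add_one _ hne, norm_mul, add_sub_cancel, Real.Gamma_two, div_one] at e0
  have e2 : ‖1 + (z.im : ℂ) * I‖ ≤ 2 * |z.im| := by
    refine (norm_add_le _ _).trans ?_
    simp
    linarith
  have hB' := hB z.re ⟨h1, h2.le⟩
  have hg := (le_abs_self _).trans hB'
  have hB0 : 0 ≤ B := (norm_nonneg _).trans hB'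
  have e3 := mul_exp_le (y := |z.im|) (half_pos hδ)
  calc ‖Gamma z‖ ≤ _ := e0
    _ ≤ B * (2 * |z.im| * (4 * |z.im| * Real.exp (-(Real.pi / 2) * |z.im|))) := by
        gcongr
        exact norm_Gamma_one_add_mul_I_le hy
    _ = B * 8 * |z.im| ^ 2 * Real.exp (-(Real.pi / 2) * |z.im|) := by ring
    _ ≤ B * 8 * (1 / (δ / 2) * Real.exp (δ / 2 * |z.im|)) ^ 2 *
          Real.exp (-(Real.pi / 2) * |z.im|) := by gcongr
    _ = B * (8 * (1 / (δ / 2)) ^ 2) * (Real.exp (δ / 2 * |z.im|) * Real.exp (δ / 2 * |z.im|) *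
          Real.exp (-(Real.pi / 2) * |z.im|)) := by ring
    _ = _ := by
        rw [← Real.exp_add, ← Real.exp_add]
        congr 2
        ring

/-- Exponential decay of `Γ` in vertical strips. -/
lemma exists_norm_Gamma_le (M : ℕ) : ∀ {δ : ℝ}, 0 < δ → ∃ C, 0 ≤ C ∧ ∀ z : ℂ,
    1 - M ≤ z.re → z.re < 2 + M → 1 ≤ |z.im| →
    ‖Gamma z‖ ≤ C * Real.exp (-(Real.pi / 2 - δ) * |z.im|) := by
  induction M with
  | zero =>
    intro δ hδ
    obtain ⟨C, hC⟩ := exists_norm_Gamma_le_base hδ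
    refine ⟨|C|, abs_nonneg C, fun z h1 h2 h3 => (hC z (by simpa using h1) (by simpa using h2) h3).trans ?_⟩
    gcongr
    exact le_abs_self C
  | succ M ih =>
    intro δ hδ
    -- Each step widens the strip by one unit on both sides with Γ(z+1) = zΓ(z). On the right the
    -- factor |z - 1| uses up the other half of δ; on the left |z| ≥ 1 helps.
    obtain ⟨C, hC0, hC⟩ := ih (half_pos hδ)
    have hM : (0 : ℝ) ≤ M := M.cast_nonneg
    refine ⟨C * ((M + 3) * (1 / (δ / 2))) + C, by positivity, fun z h1 h2 h3 => ?_⟩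
    push_cast at h1 h2
    have hmono : Real.exp (-(Real.pi / 2 - δ / 2) * |z.im|) ≤
        Real.exp (-(Real.pi / 2 - δ) * |z.im|) := by
      gcongr
      linarith
    have hp := Real.exp_pos (-(Real.pi / 2 - δ) * |z.im|)
    have hA : 0 ≤ C * ((M + 3) * (1 / (δ / 2))) := by positivity
    have him : z.im ≠ 0 := by
      intro h
      rw [h] at h3
      norm_num at h3
    by_cases ha : 1 - M ≤ z.re
    · by_cases hb : z.re < 2 + M
      · refine (hC z ha hb h3).trans ?_
        nlinarith [mul_le_mul_of_nonneg_left hmono hC0, mul_nonneg hA hp.le]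
      · have h4 := hC (z - 1) (by simp; linarith) (by simp; linarith) (by simpa using h3)
        have hne : z - 1 ≠ 0 := fun h => him (by simpa using congrArg Complex.im h)
        have h5 := Gamma_add_one (z - 1) hne
        rw [sub_add_cancel] at h5
        have e2 : ‖z - 1‖ ≤ (M + 3) * |z.im| := by
          refine (norm_le_abs_re_add_abs_im _).trans ?_
          have : |(z - 1).re| ≤ M + 2 := abs_le.2 ⟨by simp; linarith, by simp; linarith⟩
          simp only [sub_im, one_im, sub_zero]
          nlinarith
        have e3 := mul_exp_le (y := |z.im|) (half_pos hδ)
        simp only [sub_im, one_im, sub_zero] at h4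
        rw [h5, norm_mul]
        calc ‖z - 1‖ * ‖Gamma (z - 1)‖
            ≤ ((M + 3) * (1 / (δ / 2) * Real.exp (δ / 2 * |z.im|))) *
              (C * Real.exp (-(Real.pi / 2 - δ / 2) * |z.im|)) := by
              gcongr
              exact e2.trans (by gcongr)
          _ = C * ((M + 3) * (1 / (δ / 2))) * (Real.exp (δ / 2 * |z.im|) *
              Real.exp (-(Real.pi / 2 - δ / 2) * |z.im|)) := by ring
          _ = C * ((M + 3) * (1 / (δ / 2))) * Real.exp (-(Real.pi / 2 - δ) * |z.im|) := by
              rw [← Real.exp_add]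
              congr 2
              ring
          _ ≤ _ := by nlinarith [mul_nonneg hC0 hp.le]
    · have h4 := hC (z + 1) (by simp; linarith) (by simp; linarith) (by simpa using h3)
      have hne : z ≠ 0 := fun h => him (by simp [h])
      rw [Gamma_add_one z hne, norm_mul] at h4
      have h5 : 1 ≤ ‖z‖ := h3.trans (abs_im_le_norm z)
      simp only [add_im, one_im, add_zero] at h4
      have h6 : ‖Gamma z‖ ≤ ‖z‖ * ‖Gamma z‖ := le_mul_of_one_le_left (norm_nonneg _) h5
      nlinarith [mul_le_mul_of_nonneg_left hmono hC0, mul_nonneg hA hp.le]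

/-! ### Analyticity and vertical decay of the integrand. -/

lemma analyticAt_Gamma {z : ℂ} (hz : ∀ m : ℕ, z ≠ -m) : AnalyticAt ℂ Gamma z :=
  (Meromorphic.Gamma z).analyticAt (differentiableAt_Gamma z hz).continuousAt

lemma norm_rotate (d : ℕ) (ζ : ℂ) : ‖rotate d ζ‖ = ‖ζ‖ := by
  have : -((Real.pi : ℂ) / d * I) = ((-(Real.pi / d) : ℝ) : ℂ) * I := by push_cast; ring
  rw [rotate, norm_mul, this, norm_exp_ofReal_mul_I, one_mul]

lemma rotate_ne_zero (d : ℕ) {ζ : ℂ} (h : ζ ≠ 0) : rotate d ζ ≠ 0 :=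
  mul_ne_zero (exp_ne_zero _) h

lemma Gamma_add_natCast_eq_prod (z : ℂ) (n : ℕ) (h : ∀ j < n, z + j ≠ 0) :
    Gamma (z + n) = (∏ j ∈ Finset.range n, (z + j)) * Gamma z := by
  induction n with
  | zero => simp
  | succ n ih =>
    rw [Finset.prod_range_succ, Nat.cast_succ, ← add_assoc, Gamma_add_one _ (h n n.lt_succ_self),
      ih fun j hj => h j (hj.trans n.lt_succ_self)]
    ring

lemma norm_sin_le (z : ℂ) : ‖sin z‖ ≤ Real.exp |z.im| := by
  have h1 : ‖exp (-z * I)‖ = Real.exp z.im := by simp [norm_exp]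
  have h2 : ‖exp (z * I)‖ = Real.exp (-z.im) := by simp [norm_exp]
  have h3 : ‖sin z‖ ≤ (Real.exp z.im + Real.exp (-z.im)) / 2 := by
    rw [sin, norm_div, norm_mul, norm_I, mul_one]
    simp only [Complex.norm_ofNat]
    gcongr
    refine (norm_sub_le _ _).trans ?_
    rw [h1, h2]
  have h4 : Real.exp z.im ≤ Real.exp |z.im| := Real.exp_le_exp.2 (le_abs_self _)
  have h5 : Real.exp (-z.im) ≤ Real.exp |z.im| := Real.exp_le_exp.2 (neg_le_abs _)
  linarith

/-- The rate is proportional to |κ|, so that the rates of the factors Γ(αᵢ - …) add up to Σ aᵢ = d.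
The bound on δ keeps the exponent nonpositive, which allows replacing |Im(b + κz)| by the smaller
|κ||Im z| - |Im b|. -/
lemma exists_norm_Gamma_affine_le (b : ℂ) (κ A B : ℝ) {δ : ℝ} (hδ : 0 < δ) (hδ' : δ ≤ Real.pi / 2) :
    ∃ C T, 0 ≤ C ∧ ∀ z : ℂ, z.re ∈ Set.Icc A B → T ≤ |z.im| →
      ‖Gamma (b + κ * z)‖ ≤ C * Real.exp (-(Real.pi / 2 - δ) * (|κ| * |z.im|)) := by
  rcases eq_or_ne κ 0 with rfl | hκ
  · exact ⟨‖Gamma b‖, 0, norm_nonneg _, fun z _ _ => by simp⟩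
  have hκ' : 0 < |κ| := abs_pos.2 hκ
  obtain ⟨M, hM⟩ := exists_nat_gt (|b.re| + |κ| * (|A| + |B|) + 1)
  obtain ⟨C, hC0, hC⟩ := exists_norm_Gamma_le M hδ
  refine ⟨C * Real.exp (Real.pi / 2 * |b.im|), (1 + |b.im|) / |κ|, by positivity,
    fun z hz hT => ?_⟩
  have him : |κ| * |z.im| - |b.im| ≤ |(b + κ * z).im| := by
    have : (b + κ * z).im = κ * z.im - -b.im := by simp; ring
    rw [this, ← abs_mul, ← abs_neg b.im]
    exact abs_sub_abs_le_abs_sub _ _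
  rw [div_le_iff₀ hκ'] at hT
  have hre : |(b + κ * z).re| ≤ |b.re| + |κ| * (|A| + |B|) := by
    have : (b + κ * z).re = b.re + κ * z.re := by simp
    rw [this]
    refine (abs_add_le _ _).trans ?_
    rw [abs_mul]
    gcongr
    refine abs_le.2 ⟨?_, ?_⟩
    · have := neg_abs_le A; have := abs_nonneg B; linarith [hz.1]
    · have := le_abs_self B; have := abs_nonneg A; linarith [hz.2]
  obtain ⟨h1, h2⟩ := abs_le.1 hre
  refine (hC _ (by linarith) (by linarith) (by linarith)).trans ?_
  rw [mul_assoc, ← Real.exp_add]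
  gcongr
  nlinarith [mul_le_mul_of_nonneg_left him (sub_nonneg.2 hδ'), mul_nonneg hδ.le (abs_nonneg b.im)]

section integrand
variable {n d p : ℕ} {a : Fin n → ℕ} {α : Fin n → ℂ} {ζ : ℂ}

/-- The points `(αᵢ - (p/d) aᵢ + m) / aᵢ`, where `Γ(α - (p/d) a - a s)` may have a pole. -/
def gammaPoles (d p : ℕ) (a : Fin n → ℕ) (α : Fin n → ℂ) : Set ℂ :=
  {s | ∃ i, a i ≠ 0 ∧ ∃ m : ℕ, α i - (p : ℂ) / d * a i - (a i : ℂ) * s = -m}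

lemma analyticAt_gammaProd {s : ℂ} (hs : s ∉ gammaPoles d p a α) :
    AnalyticAt ℂ (fun s => gammaProd (fun i => α i - (p : ℂ) / d * a i - (a i : ℂ) * s)) s := by
  unfold gammaProd
  refine Finset.analyticAt_fun_prod _ fun i _ => ?_
  rcases eq_or_ne (a i) 0 with h0 | h0
  · simp only [h0, Nat.cast_zero, zero_mul, sub_zero]
    exact analyticAt_const
  · refine AnalyticAt.fun_comp (analyticAt_Gamma fun m hm => hs ⟨i, h0, m, hm⟩) (by fun_prop)

lemma analyticAt_sinProd (d p : ℕ) (s : ℂ) :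
    AnalyticAt ℂ (fun s => ∏ i ∈ Finset.Ico 1 d,
      sin ((Real.pi : ℂ) * (s + ((p : ℂ) + i) / d))) s :=
  Finset.analyticAt_fun_prod _ fun i _ => AnalyticAt.fun_comp analyticAt_sin (by fun_prop)

lemma analyticAt_rotate_cpow (d p : ℕ) (hζ : ζ ≠ 0) (s : ℂ) :
    AnalyticAt ℂ (fun s => rotate d ζ ^ (-((d : ℂ) * s) - p)) s := by
  simp only [cpow_def_of_ne_zero (rotate_ne_zero d hζ)]
  fun_prop

lemma analyticAt_integrandTwo (hζ : ζ ≠ 0) {s : ℂ} (hs : s ∉ gammaPoles d p a α)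
    (hs' : ∀ m : ℕ, (d : ℂ) * s ≠ -m) : AnalyticAt ℂ (integrandTwo d p a α ζ) s := by
  unfold integrandTwo
  exact (((AnalyticAt.fun_comp (analyticAt_Gamma hs') (by fun_prop)).mul (analyticAt_sinProd d p s)).mul
    (analyticAt_gammaProd hs)).mul (analyticAt_rotate_cpow d p hζ s)

lemma meromorphicAt_integrandTwo (hζ : ζ ≠ 0) (s : ℂ) :
    MeromorphicAt (integrandTwo d p a α ζ) s := by
  have hcomp : ∀ u v : ℂ, MeromorphicAt (fun s => Gamma (u + v * s)) s := fun u v =>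
    (Meromorphic.Gamma (u + v * s)).comp_analyticAt (g := fun s => u + v * s) (by fun_prop)
  unfold integrandTwo gammaProd
  refine MeromorphicAt.fun_mul (MeromorphicAt.fun_mul (MeromorphicAt.fun_mul ?_
    (analyticAt_sinProd d p s).meromorphicAt) ?_) (analyticAt_rotate_cpow d p hζ s).meromorphicAt
  · simpa using hcomp 0 d
  · refine MeromorphicAt.fun_prod fun i _ => ?_
    simpa [sub_eq_add_neg] using hcomp (α i - (p : ℂ) / d * a i) (-(a i : ℂ))

/-- Exponential decay of the integrand in vertical strips. -/
lemma exists_norm_integrandTwo_le (hd : 0 < d) (ha : ∑ i, a i = d) (hζ : ζ ∈ sector d) (A B : ℝ) :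
    ∃ C ε T, 0 < ε ∧ ∀ z : ℂ, z.re ∈ Set.Icc A B → T ≤ |z.im| →
      ‖integrandTwo d p a α ζ z‖ ≤ C * Real.exp (-ε * |z.im|) := by
  obtain ⟨hζ0, harg⟩ := hζ
  set θ := |(rotate d ζ).arg| with hθ
  have hd' : (0 : ℝ) < d := by exact_mod_cast hd
  have hη : 0 < Real.pi - d * θ := by
    rw [lt_div_iff₀ hd'] at harg
    linarith
  -- The two Gamma factors lose dδ each. With this δ the loss is half of the rate π - dθ, and the
  -- other half remains as ε.
  set δ := (Real.pi - d * θ) / (4 * d) with hδdef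
  have hδ : 0 < δ := by positivity
  have hδ4 : 4 * d * δ = Real.pi - d * θ := by rw [hδdef]; field_simp
  have hδ' : δ ≤ Real.pi / 2 := by
    have h1 : (1 : ℝ) ≤ d := by exact_mod_cast hd
    have h2 : 0 ≤ d * θ := by positivity
    nlinarith [Real.pi_pos]
  obtain ⟨C₁, T₁, hC₁, h₁⟩ := exists_norm_Gamma_affine_le 0 d A B hδ hδ'
  choose C₂ T₂ hC₂ h₂ using fun i => exists_norm_Gamma_affine_le
    (α i - (p : ℂ) / d * a i) (-(a i : ℝ)) A B hδ hδ'
  obtain ⟨C₃, hC₃⟩ := isCompact_Icc.exists_bound_of_continuousOn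
    (f := fun x : ℝ => ‖rotate d ζ‖ ^ (-(d * x) - p)) (s := Set.Icc A B) (by
      refine Continuous.continuousOn ?_
      refine Continuous.rpow continuous_const (by fun_prop) fun _ => Or.inl ?_
      exact norm_ne_zero_iff.2 (rotate_ne_zero d hζ0))
  obtain ⟨T, hT⟩ : ∃ T, T₁ ≤ T ∧ ∀ i, T₂ i ≤ T := by
    refine ⟨|T₁| + ∑ i, |T₂ i|, ?_, fun i => ?_⟩
    · have : 0 ≤ ∑ i, |T₂ i| := Finset.sum_nonneg fun i _ => abs_nonneg _
      linarith [le_abs_self T₁]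
    · have := Finset.single_le_sum (f := fun i => |T₂ i|) (fun i _ => abs_nonneg _)
        (Finset.mem_univ i)
      linarith [le_abs_self (T₂ i), abs_nonneg T₁]
  refine ⟨C₁ * (∏ i, C₂ i) * C₃, (Real.pi - d * θ) / 2, T, by linarith, fun z hz hzT => ?_⟩
  have e1 : ‖Gamma (d * z)‖ ≤ C₁ * Real.exp (-(Real.pi / 2 - δ) * (d * |z.im|)) := by
    simpa using h₁ z hz (hT.1.trans hzT)
  have e2 : ‖gammaProd (fun i => α i - (p : ℂ) / d * a i - (a i : ℂ) * z)‖ ≤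
      (∏ i, C₂ i) * Real.exp (-(Real.pi / 2 - δ) * (d * |z.im|)) := by
    rw [gammaProd, norm_prod]
    have : (∏ i, C₂ i) * Real.exp (-(Real.pi / 2 - δ) * (d * |z.im|)) =
        ∏ i, (C₂ i * Real.exp (-(Real.pi / 2 - δ) * (a i * |z.im|))) := by
      rw [Finset.prod_mul_distrib, ← Real.exp_sum, ← Finset.mul_sum, ← Finset.sum_mul, ← ha]
      push_cast
      rfl
    rw [this]
    refine Finset.prod_le_prod (fun i _ => norm_nonneg _) fun i _ => ?_
    have := h₂ i z hz ((hT.2 i).trans hzT)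
    rw [abs_neg, Nat.abs_cast] at this
    refine le_trans (le_of_eq ?_) this
    congr 2
    push_cast
    ring
  have e3 : ‖∏ i ∈ Finset.Ico 1 d, sin ((Real.pi : ℂ) * (z + ((p : ℂ) + i) / d))‖ ≤
      Real.exp (Real.pi * |z.im| * (d - 1)) := by
    rw [norm_prod]
    have : Real.exp (Real.pi * |z.im| * (d - 1)) =
        ∏ i ∈ Finset.Ico 1 d, Real.exp (Real.pi * |z.im|) := by
      rw [Finset.prod_const, Nat.card_Ico, ← Real.exp_nat_mul]
      congr 1
      push_cast [Nat.cast_sub hd]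
      ring
    rw [this]
    refine Finset.prod_le_prod (fun i _ => norm_nonneg _) fun i _ => ?_
    refine (norm_sin_le _).trans (le_of_eq ?_)
    have : (z + ((p : ℂ) + i) / d) = z + (((p + i) / d : ℝ) : ℂ) := by push_cast; ring
    rw [this, im_ofReal_mul, abs_mul, abs_of_pos Real.pi_pos]
    simp
  have e4 : ‖rotate d ζ ^ (-((d : ℂ) * z) - p)‖ ≤ C₃ * Real.exp (d * θ * |z.im|) := by
    rw [norm_cpow_of_ne_zero (rotate_ne_zero d hζ0), div_eq_mul_inv, ← Real.exp_neg]
    have h3 := hC₃ z.re hz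
    have hre : (-((d : ℂ) * z) - p).re = -(d * z.re) - p := by simp
    have him : (-((d : ℂ) * z) - p).im = -(d * z.im) := by simp
    rw [hre, him]
    rw [Real.norm_eq_abs] at h3
    have h4 := (le_abs_self _).trans h3
    have h5 : -((rotate d ζ).arg * -(d * z.im)) ≤ d * θ * |z.im| := by
      refine (le_abs_self _).trans (le_of_eq ?_)
      rw [abs_neg, abs_mul, abs_neg, abs_mul, Nat.abs_cast, ← hθ]
      ring
    gcongr
    exact (abs_nonneg _).trans h3
  have hC₂' : 0 ≤ ∏ i, C₂ i := Finset.prod_nonneg fun i _ => hC₂ i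
  rw [integrandTwo, norm_mul, norm_mul, norm_mul]
  calc _ ≤ C₁ * Real.exp (-(Real.pi / 2 - δ) * (d * |z.im|)) * Real.exp (Real.pi * |z.im| * (d - 1)) *
        ((∏ i, C₂ i) * Real.exp (-(Real.pi / 2 - δ) * (d * |z.im|))) *
        (C₃ * Real.exp (d * θ * |z.im|)) := by gcongr
    _ = C₁ * (∏ i, C₂ i) * C₃ * (Real.exp (-(Real.pi / 2 - δ) * (d * |z.im|)) *
        Real.exp (Real.pi * |z.im| * (d - 1)) * Real.exp (-(Real.pi / 2 - δ) * (d * |z.im|)) *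
        Real.exp (d * θ * |z.im|)) := by ring
    _ = _ := by
        rw [← Real.exp_add, ← Real.exp_add, ← Real.exp_add]
        congr 2
        linear_combination (|z.im| / 2) * hδ4

end integrand

/-! ### Comparison of the integrand at s + 1 and at s. -/

section shift
variable {n d p : ℕ} {a : Fin n → ℕ} {α : Fin n → ℂ} {ζ : ℂ}

/-- Denominators are cleared, so only the polynomial factors must not vanish. The identity then
holds even at poles, since `Gamma` is 0 there and Γ(z+1) = zΓ(z) persists for z ≠ 0. -/
lemma integrandTwo_add_one (hζ : ζ ≠ 0) {s : ℂ} (h₁ : ∀ j < d, (d : ℂ) * s + j ≠ 0)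
    (h₂ : ∀ i, ∀ j < a i, α i - (p : ℂ) / d * a i - (a i : ℂ) * (s + 1) + j ≠ 0) :
    rotate d ζ ^ d * (∏ i, ∏ j ∈ Finset.range (a i),
      (α i - (p : ℂ) / d * a i - (a i : ℂ) * (s + 1) + j)) * integrandTwo d p a α ζ (s + 1) =
    (-1) ^ (d - 1) * (∏ j ∈ Finset.range d, ((d : ℂ) * s + j)) * integrandTwo d p a α ζ s := by
  have e1 : Gamma (d * (s + 1)) = (∏ j ∈ Finset.range d, ((d : ℂ) * s + j)) * Gamma (d * s) := by
    rw [← Gamma_add_natCast_eq_prod _ _ h₁]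
    ring_nf
  have e2 : gammaProd (fun i => α i - (p : ℂ) / d * a i - (a i : ℂ) * s) =
      (∏ i, ∏ j ∈ Finset.range (a i), (α i - (p : ℂ) / d * a i - (a i : ℂ) * (s + 1) + j)) *
      gammaProd (fun i => α i - (p : ℂ) / d * a i - (a i : ℂ) * (s + 1)) := by
    rw [gammaProd, gammaProd, ← Finset.prod_mul_distrib]
    refine Finset.prod_congr rfl fun i _ => ?_
    rw [← Gamma_add_natCast_eq_prod _ _ (h₂ i)]
    ring_nf
  have e3 : (∏ i ∈ Finset.Ico 1 d, sin ((Real.pi : ℂ) * (s + 1 + ((p : ℂ) + i) / d))) =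
      (-1) ^ (d - 1) * ∏ i ∈ Finset.Ico 1 d, sin ((Real.pi : ℂ) * (s + ((p : ℂ) + i) / d)) := by
    have : ((-1 : ℂ)) ^ (d - 1) = ∏ i ∈ Finset.Ico 1 d, (-1) := by simp
    rw [this, ← Finset.prod_mul_distrib]
    refine Finset.prod_congr rfl fun i _ => ?_
    have e : (Real.pi : ℂ) * (s + 1 + ((p : ℂ) + i) / d) =
      (Real.pi : ℂ) * (s + ((p : ℂ) + i) / d) + Real.pi := by ring
    rw [e, sin_add_pi]
    ring
  have e4 : rotate d ζ ^ d * rotate d ζ ^ (-((d : ℂ) * (s + 1)) - p) =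
      rotate d ζ ^ (-((d : ℂ) * s) - p) := by
    rw [← cpow_natCast, ← cpow_add _ _ (rotate_ne_zero d hζ)]
    ring_nf
  simp only [integrandTwo]
  rw [e1, e2, e3, ← e4]
  ring

/-- Beyond this modulus of `s`, the factors comparing the integrand at `s + 1` and at `s`
are under control. -/
def shiftRadius (d p : ℕ) (a : Fin n → ℕ) (α : Fin n → ℂ) : ℝ :=
  2 + 2 * ∑ i, ‖α i - (p : ℂ) / d * a i‖

lemma shiftRadius_ge (i : Fin n) : 2 + 2 * ‖α i - (p : ℂ) / d * a i‖ ≤ shiftRadius d p a α := by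
  have := Finset.single_le_sum (f := fun i => ‖α i - (p : ℂ) / d * a i‖)
    (fun i _ => norm_nonneg _) (Finset.mem_univ i)
  unfold shiftRadius
  linarith

lemma two_le_shiftRadius : 2 ≤ shiftRadius d p a α := by
  have : 0 ≤ ∑ i, ‖α i - (p : ℂ) / d * a i‖ := Finset.sum_nonneg fun i _ => norm_nonneg _
  unfold shiftRadius
  linarith

lemma left_factor_bounds (hd : 0 < d) {s : ℂ} (hs : 2 ≤ ‖s‖) {j : ℕ} (hj : j < d) :
    d * ‖s‖ / 2 ≤ ‖(d : ℂ) * s + j‖ ∧ ‖(d : ℂ) * s + j‖ ≤ 2 * d * ‖s‖ := by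
  have hd' : (0 : ℝ) < d := by exact_mod_cast hd
  have hj' : (j : ℝ) ≤ d := by exact_mod_cast hj.le
  have e1 : ‖(d : ℂ) * s‖ = d * ‖s‖ := by simp
  have e2 : ‖(j : ℂ)‖ = j := by simp
  have h1 := norm_sub_le_norm_add ((d : ℂ) * s) j
  have h2 := norm_add_le ((d : ℂ) * s) j
  rw [e1, e2] at h1 h2
  constructor <;> nlinarith

/-- The term b - (k - j) has modulus at most half of k|s|, by the assumption on |s| and k ≥ 1. -/
lemma right_factor_bounds {b s : ℂ} {k : ℕ} (hkd : k ≤ d) (hs : 2 + 2 * ‖b‖ ≤ ‖s‖) {j : ℕ}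
    (hj : j < k) :
    ‖s‖ / 2 ≤ ‖b - (k : ℂ) * (s + 1) + j‖ ∧ ‖b - (k : ℂ) * (s + 1) + j‖ ≤ 3 * d * ‖s‖ := by
  have hk1 : (1 : ℝ) ≤ k := by exact_mod_cast (Nat.succ_le_of_lt (by omega : 0 < k))
  have hkd' : (k : ℝ) ≤ d := by exact_mod_cast hkd
  have hb := norm_nonneg b
  have e0 : b - (k : ℂ) * (s + 1) + j = -((k : ℂ) * s) + (b - ((k - j : ℕ) : ℂ)) := by
    rw [Nat.cast_sub hj.le]
    ring
  have e1 : ‖-((k : ℂ) * s)‖ = k * ‖s‖ := by simp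
  have e2 : ‖b - ((k - j : ℕ) : ℂ)‖ ≤ ‖b‖ + k := by
    refine (norm_sub_le _ _).trans ?_
    rw [norm_natCast]
    have : ((k - j : ℕ) : ℝ) ≤ k := by exact_mod_cast Nat.sub_le _ _
    linarith
  have h1 := norm_sub_le_norm_add (-((k : ℂ) * s)) (b - ((k - j : ℕ) : ℂ))
  have h2 := norm_add_le (-((k : ℂ) * s)) (b - ((k - j : ℕ) : ℂ))
  rw [e0]
  rw [e1] at h1 h2
  constructor <;> nlinarith

/-- Two-sided comparison of the integrand at `s + 1` and at `s`, for `|s|` large. -/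
lemma norm_integrandTwo_add_one (hd : 0 < d) (ha : ∑ i, a i = d) (hζ : ζ ≠ 0) {s : ℂ}
    (hs : shiftRadius d p a α ≤ ‖s‖) :
    ‖integrandTwo d p a α ζ (s + 1)‖ ≤ (4 * d / ‖ζ‖) ^ d * ‖integrandTwo d p a α ζ s‖ ∧
    ‖integrandTwo d p a α ζ s‖ ≤ (6 * ‖ζ‖) ^ d * ‖integrandTwo d p a α ζ (s + 1)‖ := by
  have hd' : (0 : ℝ) < d := by exact_mod_cast hd
  have hs2 : 2 ≤ ‖s‖ := two_le_shiftRadius.trans hs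
  have hs0 : 0 < ‖s‖ := by linarith
  have hζ' : 0 < ‖ζ‖ := norm_pos_iff.2 hζ
  have hle : ∀ i, a i ≤ d := fun i => ha ▸ Finset.single_le_sum (fun i _ => Nat.zero_le (a i))
    (Finset.mem_univ i)
  have h1 := fun j (hj : j < d) => left_factor_bounds hd hs2 hj
  have h2 := fun i j (hj : j < a i) => right_factor_bounds (hle i)
    ((shiftRadius_ge (d := d) (p := p) (a := a) (α := α) i).trans hs) hj
  have key := integrandTwo_add_one (p := p) (a := a) (α := α) hζ (s := s)
    (fun j hj => norm_pos_iff.1 (lt_of_lt_of_le (by positivity) (h1 j hj).1))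
    (fun i j hj => norm_pos_iff.1 (lt_of_lt_of_le (by positivity) (h2 i j hj).1))
  set N := ∏ j ∈ Finset.range d, ((d : ℂ) * s + j) with hN
  set D := ∏ i, ∏ j ∈ Finset.range (a i),
      (α i - (p : ℂ) / d * a i - (a i : ℂ) * (s + 1) + j) with hD
  have key' : ‖ζ‖ ^ d * ‖D‖ * ‖integrandTwo d p a α ζ (s + 1)‖ =
      ‖N‖ * ‖integrandTwo d p a α ζ s‖ := by
    have := congrArg norm key
    simpa only [norm_mul, norm_pow, norm_rotate, norm_neg, norm_one, one_pow, one_mul] using this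
  have hNl : (d * ‖s‖ / 2) ^ d ≤ ‖N‖ := by
    rw [hN, norm_prod]
    calc _ = ∏ j ∈ Finset.range d, (d * ‖s‖ / 2) := by
          rw [Finset.prod_const, Finset.card_range]
      _ ≤ _ := Finset.prod_le_prod (fun _ _ => by positivity)
          fun j hj => (h1 j (Finset.mem_range.1 hj)).1
  have hNu : ‖N‖ ≤ (2 * d * ‖s‖) ^ d := by
    rw [hN, norm_prod]
    calc _ ≤ ∏ j ∈ Finset.range d, (2 * d * ‖s‖) := Finset.prod_le_prod (fun _ _ => norm_nonneg _)
          fun j hj => (h1 j (Finset.mem_range.1 hj)).2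
      _ = _ := by simp
  -- D has Σ aᵢ = d linear factors, as many as N, so the powers of |s| cancel in the comparison.
  have hpow : ∀ x : ℝ, x ^ d = ∏ i, ∏ j ∈ Finset.range (a i), x := fun x => by
    simp [Finset.prod_pow_eq_pow_sum, ha]
  have hDl : (‖s‖ / 2) ^ d ≤ ‖D‖ := by
    rw [hD, norm_prod, hpow]
    refine Finset.prod_le_prod (fun _ _ => Finset.prod_nonneg fun _ _ => by positivity)
      fun i _ => ?_
    rw [norm_prod]
    exact Finset.prod_le_prod (fun _ _ => by positivity)
      fun j hj => (h2 i j (Finset.mem_range.1 hj)).1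
  have hDu : ‖D‖ ≤ (3 * d * ‖s‖) ^ d := by
    rw [hD, norm_prod, hpow]
    refine Finset.prod_le_prod (fun _ _ => norm_nonneg _) fun i _ => ?_
    rw [norm_prod]
    exact Finset.prod_le_prod (fun _ _ => norm_nonneg _)
      fun j hj => (h2 i j (Finset.mem_range.1 hj)).2
  have g0 := norm_nonneg (integrandTwo d p a α ζ s)
  have g1 := norm_nonneg (integrandTwo d p a α ζ (s + 1))
  constructor
  · have hpos : 0 < ‖ζ‖ ^ d * (‖s‖ / 2) ^ d := by positivity
    refine le_of_mul_le_mul_left ?_ hpos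
    calc ‖ζ‖ ^ d * (‖s‖ / 2) ^ d * ‖integrandTwo d p a α ζ (s + 1)‖
        ≤ ‖ζ‖ ^ d * ‖D‖ * ‖integrandTwo d p a α ζ (s + 1)‖ := by gcongr
      _ = ‖N‖ * ‖integrandTwo d p a α ζ s‖ := key'
      _ ≤ (2 * d * ‖s‖) ^ d * ‖integrandTwo d p a α ζ s‖ := by gcongr
      _ = _ := by
        rw [← mul_assoc, ← mul_pow, ← mul_pow]
        congr 2
        field_simp
        ring
  · have hpos : 0 < (d * ‖s‖ / 2) ^ d := by positivity
    refine le_of_mul_le_mul_left ?_ hpos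
    calc (d * ‖s‖ / 2) ^ d * ‖integrandTwo d p a α ζ s‖
        ≤ ‖N‖ * ‖integrandTwo d p a α ζ s‖ := by gcongr
      _ = ‖ζ‖ ^ d * ‖D‖ * ‖integrandTwo d p a α ζ (s + 1)‖ := key'.symm
      _ ≤ ‖ζ‖ ^ d * (3 * d * ‖s‖) ^ d * ‖integrandTwo d p a α ζ (s + 1)‖ := by gcongr
      _ = _ := by
        rw [← mul_assoc, ← mul_pow, ← mul_pow]
        congr 2
        ring

lemma norm_integrandTwo_add_nat_le (hd : 0 < d) (ha : ∑ i, a i = d) (hζ : ζ ≠ 0) {s : ℂ}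
    (hs : shiftRadius d p a α ≤ s.re) (N : ℕ) :
    ‖integrandTwo d p a α ζ (s + N)‖ ≤
      ((4 * d / ‖ζ‖) ^ d) ^ N * ‖integrandTwo d p a α ζ s‖ := by
  induction N with
  | zero => simp
  | succ N ih =>
    have h : shiftRadius d p a α ≤ ‖s + N‖ := by
      refine le_trans ?_ ((le_abs_self _).trans (abs_re_le_norm _))
      have : (0 : ℝ) ≤ N := N.cast_nonneg
      simp
      linarith
    have h1 := (norm_integrandTwo_add_one hd ha hζ h).1
    rw [Nat.cast_succ, ← add_assoc]
    refine h1.trans ?_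
    rw [pow_succ, mul_comm (((4 * d / ‖ζ‖) ^ d) ^ N), mul_assoc]
    gcongr

lemma norm_integrandTwo_sub_nat_le (hd : 0 < d) (ha : ∑ i, a i = d) (hζ : ζ ≠ 0) {s : ℂ}
    (hs : s.re ≤ -shiftRadius d p a α) (N : ℕ) :
    ‖integrandTwo d p a α ζ (s - N)‖ ≤
      ((6 * ‖ζ‖) ^ d) ^ N * ‖integrandTwo d p a α ζ s‖ := by
  induction N with
  | zero => simp
  | succ N ih =>
    have h : shiftRadius d p a α ≤ ‖s - (N + 1 : ℕ)‖ := by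
      refine le_trans ?_ ((neg_le_abs _).trans (abs_re_le_norm _))
      have : (0 : ℝ) ≤ N := N.cast_nonneg
      simp
      linarith
    have h1 := (norm_integrandTwo_add_one (ζ := ζ) hd ha hζ h).2
    have e : s - (N + 1 : ℕ) + 1 = s - N := by push_cast; ring
    rw [e] at h1
    refine h1.trans ?_
    rw [pow_succ, mul_comm (((6 * ‖ζ‖) ^ d) ^ N), mul_assoc]
    gcongr

end shift

/-! ### Tools for computing and estimating residues; the sine product. -/

lemma residue_div_sub {h f : ℂ → ℂ} {s₀ : ℂ} (hh : AnalyticAt ℂ h s₀)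
    (hf : ∀ᶠ z in 𝓝[≠] s₀, f z = h z / (z - s₀)) : residue f s₀ = h s₀ := by
  obtain ⟨q, hq⟩ := hh
  refine residue_eq_of_singularPart (g := dslope h s₀) (E := fun z => h s₀ / (z - s₀))
    hq.has_fpower_series_dslope_fslope.analyticAt
    ⟨fun _ => 0, fun z hz => ⟨?_, by simpa using hasDerivAt_const z (0 : ℂ)⟩⟩ ?_
  · exact analyticAt_const.div (by fun_prop) (sub_ne_zero.2 hz)
  · filter_upwards [hf, self_mem_nhdsWithin] with z hz hne
    have hne' : z - s₀ ≠ 0 := sub_ne_zero.2 hne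
    rw [hz, dslope_of_ne _ hne, slope_def_field]
    field_simp
    ring

lemma residue_comp_add (f : ℂ → ℂ) (s₀ w : ℂ) :
    residue (fun z => f (z + w)) s₀ = residue f (s₀ + w) := by
  unfold residue
  congr 1
  ext r
  congr 1
  simp only [circleIntegral, deriv_circleMap]
  congr 1
  ext θ
  congr 2
  simp [circleMap]
  ring

/-- Cauchy's theorem on an annulus replaces the small circles by one of fixed radius. No information
on the order of the pole is needed. -/
lemma norm_residue_le {f : ℂ → ℂ} {s₀ : ℂ} {ρ M : ℝ} (hρ : 0 < ρ)
    (hf : ∀ z ∈ Metric.closedBall s₀ ρ, z ≠ s₀ → AnalyticAt ℂ f z)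
    (hM : ∀ z ∈ Metric.sphere s₀ ρ, ‖f z‖ ≤ M) : ‖residue f s₀‖ ≤ ρ * M := by
  have h : residue f s₀ = (2 * (Real.pi : ℂ) * I)⁻¹ * ∮ z in C(s₀, ρ), f z := by
    refine Tendsto.limUnder_eq (tendsto_const_nhds.congr' ?_)
    filter_upwards [Ioc_mem_nhdsGT hρ] with r hr
    congr 1
    have hne : ∀ z, z ∈ Metric.closedBall s₀ ρ \ Metric.ball s₀ r → z ≠ s₀ := by
      rintro z hz rfl
      exact hz.2 (Metric.mem_ball_self hr.1)
    refine circleIntegral_eq_of_differentiable_on_annulus_off_countable hr.1 hr.2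
      Set.countable_empty (fun z hz => ?_) fun z hz => ?_
    · exact (hf z hz.1 (hne z hz)).continuousAt.continuousWithinAt
    · have hz1 := hz.1
      exact (hf z (Metric.ball_subset_closedBall hz1.1) (hne z
        ⟨Metric.ball_subset_closedBall hz1.1, fun h => hz1.2 (Metric.ball_subset_closedBall h)⟩)).differentiableAt
  rw [h, ← smul_eq_mul]
  exact circleIntegral.norm_two_pi_i_inv_smul_integral_le_of_norm_le_const hρ.le hM

/-- For ω = exp(2πi/d) one has ∏ (1 - ω^k) = d over 0 < k < d, and each factor is 2 sin(πk/d) times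
the phase -i exp(πik/d). -/
lemma two_pow_mul_prod_sin {d : ℕ} (hd : 0 < d) :
    2 ^ (d - 1) * ∏ i ∈ Finset.Ico 1 d, sin ((Real.pi : ℂ) * ((i : ℂ) / d)) = d := by
  obtain ⟨m, rfl⟩ : ∃ m, d = m + 1 := ⟨d - 1, by omega⟩
  have hne : ((m + 1 : ℕ) : ℂ) ≠ 0 := by exact_mod_cast hd.ne'
  have h := (isPrimitiveRoot_exp (m + 1) hd.ne').prod_one_sub_pow_eq_order
  set x : ℂ := Real.pi * I / (m + 1 : ℕ) with hx
  have e1 : ∀ k : ℕ, 1 - exp (2 * Real.pi * I / (m + 1 : ℕ)) ^ (k + 1) =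
      2 * sin ((Real.pi : ℂ) * (((k + 1 : ℕ) : ℂ) / (m + 1 : ℕ))) *
        (-I * exp ((k + 1 : ℕ) * x)) := by
    intro k
    rw [← exp_nat_mul, sin]
    have a1 : (Real.pi : ℂ) * (((k + 1 : ℕ) : ℂ) / (m + 1 : ℕ)) * I = (k + 1 : ℕ) * x := by
      rw [hx]; ring
    have a2 : -((Real.pi : ℂ) * (((k + 1 : ℕ) : ℂ) / (m + 1 : ℕ))) * I = -((k + 1 : ℕ) * x) := by
      rw [hx]; ring
    have a3 : ((k + 1 : ℕ) : ℂ) * (2 * Real.pi * I / (m + 1 : ℕ)) =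
        (k + 1 : ℕ) * x + (k + 1 : ℕ) * x := by
      rw [hx]; ring
    rw [a1, a2, a3, exp_add, exp_neg]
    have := exp_ne_zero ((k + 1 : ℕ) * x)
    field_simp
    linear_combination (1 - exp ((k + 1 : ℕ) * x) ^ 2) * I_sq
  -- The phases multiply to (-i)^m i^m = 1, where m = d - 1.
  have e2 : ∏ k ∈ Finset.range m, (-I * exp ((k + 1 : ℕ) * x)) = 1 := by
    rw [Finset.prod_mul_distrib, ← exp_sum, ← Finset.sum_mul, Finset.prod_const, Finset.card_range]
    have hs : ∑ k ∈ Finset.range m, ((k + 1 : ℕ) : ℂ) = m * (m + 1) / 2 := by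
      clear_value x
      clear h e1 hx hne hd
      induction m with
      | zero => simp
      | succ m ih => rw [Finset.sum_range_succ, ih]; push_cast; ring
    rw [hs]
    have : (m : ℂ) * (m + 1) / 2 * x = m * (Real.pi / 2 * I) := by
      rw [hx]
      push_cast at hne ⊢
      field_simp
    rw [this, exp_nat_mul, exp_pi_div_two_mul_I, ← mul_pow]
    simp
  simp only [e1] at h
  rw [Finset.prod_mul_distrib, e2, mul_one, Finset.prod_mul_distrib, Finset.prod_const,
    Finset.card_range] at h
  rw [Finset.range_eq_Ico, Finset.prod_Ico_add' (fun k : ℕ =>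
    sin ((Real.pi : ℂ) * ((k : ℂ) / (m + 1 : ℕ)))) 0 m 1, zero_add] at h
  rw [Nat.add_sub_cancel, h]
  push_cast
  rfl

/-! ### Residues at the poles of Γ(ds) and the terms of the series. -/

section leftPoles
variable {n d p : ℕ} {a : Fin n → ℕ} {α : Fin n → ℂ} {ζ : ℂ}

lemma prod_range_neg_add (m : ℕ) :
    ∏ j ∈ Finset.range m, (-(m : ℂ) + j) = (-1) ^ m * m.factorial := by
  rw [← Finset.prod_range_reflect, ← Finset.prod_range_add_one_eq_factorial, Nat.cast_prod,
    ← Finset.card_range m, ← Finset.prod_const, Finset.card_range, ← Finset.prod_mul_distrib]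
  refine Finset.prod_congr rfl fun j hj => ?_
  have hj : j < m := Finset.mem_range.1 hj
  have e : m - 1 - j = m - (j + 1) := by omega
  rw [e, Nat.cast_sub (by omega)]
  push_cast
  ring

/-- In Γ(ds + m + 1) = ∏_{j ≤ m} (ds + j) Γ(ds) the left side is 1 at s = -m/d, and the factor j = m
equals d(s + m/d). This exhibits an at most simple pole, with coefficient (-1)^m / (d m!) from
Γ(ds). -/
lemma residue_integrandTwo (hd : 0 < d) (hζ : ζ ≠ 0) (m : ℕ)
    (hP : -((m : ℂ) / d) ∉ gammaPoles d p a α) :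
    residue (integrandTwo d p a α ζ) (-((m : ℂ) / d)) =
      (d * ((-1) ^ m * (m.factorial : ℂ)))⁻¹ *
      (∏ i ∈ Finset.Ico 1 d, sin ((Real.pi : ℂ) * (-((m : ℂ) / d) + ((p : ℂ) + i) / d))) *
      gammaProd (fun i => α i - (p : ℂ) / d * a i - (a i : ℂ) * -((m : ℂ) / d)) *
      rotate d ζ ^ (-((d : ℂ) * -((m : ℂ) / d)) - p) := by
  have hd' : (d : ℂ) ≠ 0 := by exact_mod_cast hd.ne'
  set s₀ : ℂ := -((m : ℂ) / d) with hs₀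
  have hds : (d : ℂ) * s₀ = -m := by rw [hs₀]; field_simp
  have hj : ∀ j < m, (d : ℂ) * s₀ + j ≠ 0 := fun j hj h => by
    rw [hds, neg_add_eq_zero] at h
    have : m = j := by exact_mod_cast h
    omega
  have hprod : ∏ j ∈ Finset.range m, ((d : ℂ) * s₀ + j) ≠ 0 :=
    Finset.prod_ne_zero_iff.2 fun j hj' => hj j (Finset.mem_range.1 hj')
  have hG1 : Gamma (d * s₀ + (m + 1 : ℕ)) = 1 := by
    rw [hds]
    simp
  have hpa : AnalyticAt ℂ (fun z => ∏ j ∈ Finset.range m, ((d : ℂ) * z + j)) s₀ :=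
    Finset.analyticAt_fun_prod _ fun _ _ => by fun_prop
  have hGa : AnalyticAt ℂ (fun z : ℂ => Gamma (d * z + (m + 1 : ℕ))) s₀ := by
    refine AnalyticAt.fun_comp (analyticAt_Gamma fun k h => ?_) (by fun_prop)
    rw [hds] at h
    have h2 := congrArg Complex.re h
    simp at h2
    have : (0 : ℝ) ≤ k := k.cast_nonneg
    linarith
  have hh := (((hGa.fun_div (analyticAt_const.fun_mul hpa) (mul_ne_zero hd' hprod)).fun_mul
    (analyticAt_sinProd d p s₀)).fun_mul (analyticAt_gammaProd hP)).fun_mul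
      (analyticAt_rotate_cpow d p hζ s₀)
  rw [residue_div_sub hh]
  · rw [hG1]
    simp only [hds, prod_range_neg_add, one_div]
  · have hev : ∀ᶠ z in 𝓝[≠] s₀, ∏ j ∈ Finset.range m, ((d : ℂ) * z + j) ≠ 0 :=
      (hpa.continuousAt.eventually_ne hprod).filter_mono nhdsWithin_le_nhds
    filter_upwards [hev, self_mem_nhdsWithin] with z hz hne
    have hne' : z - s₀ ≠ 0 := sub_ne_zero.2 hne
    have hlast : (d : ℂ) * z + m = d * (z - s₀) := by rw [mul_sub, hds]; ring
    have hz' : ∀ j < m + 1, (d : ℂ) * z + j ≠ 0 := fun j hj' => by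
      rcases Nat.lt_succ_iff_lt_or_eq.1 hj' with h | h
      · exact Finset.prod_ne_zero_iff.1 hz j (Finset.mem_range.2 h)
      · rw [h, hlast]
        exact mul_ne_zero hd' hne'
    rw [Gamma_add_natCast_eq_prod _ _ hz', Finset.prod_range_succ, hlast, integrandTwo]
    field_simp

lemma rotate_pow (hd : 0 < d) (ζ : ℂ) : rotate d ζ ^ d = -ζ ^ d := by
  have hd' : (d : ℂ) ≠ 0 := by exact_mod_cast hd.ne'
  rw [rotate, mul_pow, ← exp_nat_mul]
  have : (d : ℂ) * -((Real.pi : ℂ) / d * I) = -(Real.pi * I) := by field_simp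
  rw [this, exp_neg, exp_pi_mul_I]
  norm_num

lemma residue_integrandTwo_eq_lacunaryTerm (hd : 0 < d) (hζ : ζ ≠ 0) (k : ℕ)
    (hP : -(((p + d * k : ℕ) : ℂ) / d) ∉ gammaPoles d p a α) :
    (-1) ^ p * 2 ^ (d - 1) * residue (integrandTwo d p a α ζ) (-(((p + d * k : ℕ) : ℂ) / d)) =
      lacunaryTerm d p a α ζ k := by
  have hd' : (d : ℂ) ≠ 0 := by exact_mod_cast hd.ne'
  rw [residue_integrandTwo hd hζ _ hP]
  have e1 : (∏ i ∈ Finset.Ico 1 d,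
      sin ((Real.pi : ℂ) * (-(((p + d * k : ℕ) : ℂ) / d) + ((p : ℂ) + i) / d))) =
      ((-1) ^ k) ^ (d - 1) * ∏ i ∈ Finset.Ico 1 d, sin ((Real.pi : ℂ) * ((i : ℂ) / d)) := by
    rw [← Nat.card_Ico 1 d, ← Finset.prod_const, ← Finset.prod_mul_distrib]
    refine Finset.prod_congr rfl fun i _ => ?_
    rw [← sin_antiperiodic.sub_nat_mul_eq]
    congr 1
    push_cast
    field_simp
    ring
  have e2 : (fun i => α i - (p : ℂ) / d * a i - (a i : ℂ) * -(((p + d * k : ℕ) : ℂ) / d)) =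
      fun i => α i + (k : ℂ) * a i := by
    ext i
    push_cast
    field_simp
    ring
  have e3 : rotate d ζ ^ (-((d : ℂ) * -(((p + d * k : ℕ) : ℂ) / d)) - p) =
      (-1) ^ k * ζ ^ (d * k) := by
    have : (-((d : ℂ) * -(((p + d * k : ℕ) : ℂ) / d)) - p) = ((d * k : ℕ) : ℂ) := by
      push_cast
      field_simp
      ring
    rw [this, cpow_natCast, pow_mul, rotate_pow hd, neg_pow, ← pow_mul]
  have e4 : Gamma (1 + p + (d : ℂ) * k) = (p + d * k).factorial := by
    rw [← Gamma_nat_eq_factorial]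
    congr 1
    push_cast
    ring
  have hsin := two_pow_mul_prod_sin hd
  have hfac : ((p + d * k).factorial : ℂ) ≠ 0 := by exact_mod_cast (p + d * k).factorial_ne_zero
  -- The sines contribute (-1)^(k(d-1)) and the rotation w^(dk) = (-1)^k ζ^(dk). Together they
  -- cancel the sign of the residue of Γ(ds) against (-1)^p.
  have hsign : ((-1 : ℂ)) ^ p * ((-1) ^ (p + d * k))⁻¹ * (((-1) ^ k) ^ (d - 1) * (-1) ^ k) = 1 := by
    rw [← pow_succ, Nat.sub_add_cancel hd, ← pow_mul, mul_comm k d, mul_assoc,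
      mul_left_comm, ← pow_add, inv_mul_cancel₀]
    exact pow_ne_zero _ (by norm_num)
  rw [e1, e2, e3, lacunaryTerm, e4, mul_inv, mul_inv]
  calc _ = ((-1 : ℂ) ^ p * ((-1) ^ (p + d * k))⁻¹ * (((-1) ^ k) ^ (d - 1) * (-1) ^ k)) *
        ((2 ^ (d - 1) * ∏ i ∈ Finset.Ico 1 d, sin ((Real.pi : ℂ) * ((i : ℂ) / d))) * (d : ℂ)⁻¹) *
        (((p + d * k).factorial : ℂ)⁻¹ * gammaProd (fun i => α i + (k : ℂ) * a i) *
          ζ ^ (d * k)) := by ring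
    _ = _ := by
        rw [hsign, hsin, mul_inv_cancel₀ hd']
        ring

/-- The poles of `Γ(ds)` outside `-p/d - ℕ` are cancelled by the sines. -/
lemma residue_integrandTwo_eq_zero (hd : 0 < d) (hζ : ζ ≠ 0) {m i : ℕ} {k : ℤ} (hi : i ∈ Finset.Ico 1 d)
    (hm : (m : ℤ) = p + i + d * k) (hP : -((m : ℂ) / d) ∉ gammaPoles d p a α) :
    residue (integrandTwo d p a α ζ) (-((m : ℂ) / d)) = 0 := by
  have hd' : (d : ℂ) ≠ 0 := by exact_mod_cast hd.ne'
  rw [residue_integrandTwo hd hζ _ hP]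
  have hm' : (m : ℂ) = p + i + d * k := by exact_mod_cast congrArg (Int.cast (R := ℂ)) hm
  have : (Real.pi : ℂ) * (-((m : ℂ) / d) + ((p : ℂ) + i) / d) = ((-k : ℤ) : ℂ) * Real.pi := by
    rw [hm']
    push_cast
    field_simp
    ring
  rw [Finset.prod_eq_zero hi (by rw [this, sin_int_mul_pi])]
  ring

lemma sum_range_residue_integrandTwo (hd : 0 < d) (hp : p < d) (hζ : ζ ≠ 0)
    (hP : ∀ m : ℕ, -((m : ℂ) / d) ∉ gammaPoles d p a α) (N : ℕ) :
    (-1) ^ p * 2 ^ (d - 1) * ∑ m ∈ Finset.range (p + d * N),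
      residue (integrandTwo d p a α ζ) (-((m : ℂ) / d)) =
    ∑ k ∈ Finset.range N, lacunaryTerm d p a α ζ k := by
  induction N with
  | zero =>
    rw [Finset.sum_eq_zero]
    · simp
    · intro m hm
      have hm : m < p := by simpa using hm
      -- For m < p one has m - p = i - d with 0 < i < d, as p < d; that sine vanishes.
      exact residue_integrandTwo_eq_zero hd hζ (i := d + m - p) (k := -1)
        (Finset.mem_Ico.2 (by omega)) (by push_cast [Nat.cast_sub (by omega : p ≤ d + m)]; ring) (hP m)
  | succ N ih =>
    rw [Finset.sum_range_succ, ← ih, ← residue_integrandTwo_eq_lacunaryTerm hd hζ N (hP _), Nat.mul_succ,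
      ← add_assoc, Finset.sum_range_add, mul_add]
    congr 1
    obtain ⟨e, rfl⟩ : ∃ e, d = e + 1 := ⟨d - 1, by omega⟩
    -- In each block of d consecutive poles starting at p + dN only the first one survives.
    rw [Finset.sum_range_succ', Finset.sum_eq_zero, zero_add]
    · simp
    · intro j hj
      have hj := Finset.mem_range.1 hj
      exact residue_integrandTwo_eq_zero hd hζ (i := j + 1) (k := N)
        (Finset.mem_Ico.2 (by omega)) (by push_cast; ring) (hP _)

end leftPoles

/-! ### Equality of the two forms of the integral. -/

section firstForm
variable {n d p : ℕ} {a : Fin n → ℕ} {α : Fin n → ℂ} {ζ : ℂ}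

/-- At ds + p the product (1-s)_p becomes (-1)^p ∏_{j<p} (ds + j), which is, up to sign, the
quotient Γ(ds+p)/Γ(ds). -/
lemma integrandOne_mul_add (hd : 0 < d) {s : ℂ} (hs : 0 < s.re) :
    integrandOne d p a α ζ (d * s + p) = (-1) ^ p * integrandTwo d p a α ζ s := by
  have hd' : (d : ℂ) ≠ 0 := by exact_mod_cast hd.ne'
  have hdr : (0 : ℝ) < d := by exact_mod_cast hd
  have hj : ∀ j < p, (d : ℂ) * s + j ≠ 0 := fun j _ h => by
    have := congrArg Complex.re h
    simp at this
    have h0 : (0 : ℝ) ≤ j := j.cast_nonneg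
    have := mul_pos hdr hs
    linarith
  have hprod : ∏ j ∈ Finset.range p, ((d : ℂ) * s + j) ≠ 0 :=
    Finset.prod_ne_zero_iff.2 fun j hj' => hj j (Finset.mem_range.1 hj')
  have e1 : oneSubPoch p (d * s + p) = (-1) ^ p * ∏ j ∈ Finset.range p, ((d : ℂ) * s + j) := by
    rw [← Finset.prod_range_reflect, oneSubPoch, Finset.range_eq_Ico]
    have : ((-1 : ℂ)) ^ p = ∏ j ∈ Finset.Ico 0 p, (-1) := by simp
    rw [this, ← Finset.prod_mul_distrib, ← Finset.Ico_add_one_right_eq_Icc,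
      ← Finset.prod_Ico_add' _ 0 p 1]
    refine Finset.prod_congr rfl fun j hj => ?_
    have hj := (Finset.mem_Ico.1 hj).2
    have e : p - 1 - j = p - (j + 1) := by omega
    rw [e, Nat.cast_sub (by omega)]
    push_cast
    ring
  have e2 : (∏ i ∈ Finset.Ico 1 d, sin ((Real.pi : ℂ) * ((d : ℂ) * s + p + i) / d)) =
      ∏ i ∈ Finset.Ico 1 d, sin ((Real.pi : ℂ) * (s + ((p : ℂ) + i) / d)) := by
    refine Finset.prod_congr rfl fun i _ => ?_
    congr 1
    field_simp
    ring
  have e3 : (fun i => α i - (a i : ℂ) / d * ((d : ℂ) * s + p)) =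
      fun i => α i - (p : ℂ) / d * a i - (a i : ℂ) * s := by
    ext i
    field_simp
    ring
  have e4 : -((d : ℂ) * s + p) = -((d : ℂ) * s) - p := by ring
  rw [integrandOne, integrandTwo, e1, e2, e3, e4, Gamma_add_natCast_eq_prod _ _ hj]
  have hsq : ((-1 : ℂ) ^ p)⁻¹ = (-1) ^ p := by rw [← inv_pow]; norm_num
  rw [div_eq_mul_inv, mul_inv, hsq]
  field_simp

lemma integrandOne_line (hd : 0 < d) {c : ℝ} (hc : 0 < c) (t : ℝ) :
    integrandOne d p a α ζ (((d : ℝ) * c + p : ℝ) + (d * t : ℝ) * I) =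
      (-1) ^ p * integrandTwo d p a α ζ (c + t * I) := by
  rw [← integrandOne_mul_add hd (by simpa using hc)]
  congr 1
  push_cast
  ring

lemma verticalIntegrable_integrandOne (hd : 0 < d) {c : ℝ} (hc : 0 < c)
    (h : VerticalIntegrable (integrandTwo d p a α ζ) c) :
    VerticalIntegrable (integrandOne d p a α ζ) ((d : ℝ) * c + p) := by
  have hdr : (d : ℝ) ≠ 0 := by exact_mod_cast hd.ne'
  unfold VerticalIntegrable at h ⊢
  rw [← MeasureTheory.integrable_comp_mul_left_iff _ hdr]
  simp only [integrandOne_line hd hc]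
  exact h.const_mul _

lemma integralOne_eq_integralTwo (hd : 0 < d) {c : ℝ} (hc : 0 < c) :
    integralOne d p a α ζ ((d : ℝ) * c + p) = integralTwo d p a α ζ c := by
  have hdr : (d : ℂ) ≠ 0 := by exact_mod_cast hd.ne'
  have h := MeasureTheory.Measure.integral_comp_mul_left
    (fun t : ℝ => integrandOne d p a α ζ (((d : ℝ) * c + p : ℝ) + t * I)) (d : ℝ)
  simp only [integrandOne_line hd hc, MeasureTheory.integral_const_mul] at h
  rw [abs_of_nonneg (by positivity), real_smul] at h
  unfold integralOne integralTwo verticalIntegral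
  generalize (∫ t : ℝ, integrandTwo d p a α ζ (c + t * I)) = B at h ⊢
  generalize (∫ t : ℝ, integrandOne d p a α ζ (((d : ℝ) * c + p : ℝ) + t * I)) = A at h ⊢
  have hA : A = d * ((-1) ^ p * B) := by
    rw [h]
    push_cast
    field_simp
  rw [hA]
  field_simp

end firstForm

/-! ### Location of the poles, estimates on lines, convergence of the series. -/

section lines
variable {n d p : ℕ} {a : Fin n → ℕ} {α : Fin n → ℂ} {ζ : ℂ}

lemma lt_re_of_mem_gammaPoles {c : ℝ} (hc : c ∈ abscissas d p a α) {s : ℂ}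
    (hs : s ∈ gammaPoles d p a α) : c < s.re := by
  obtain ⟨i, hi, m, hm⟩ := hs
  have h1 := hc.2 i hi
  have h2 := congrArg Complex.re hm
  have ha : (0 : ℝ) < a i := by exact_mod_cast Nat.pos_of_ne_zero hi
  have hm0 : (0 : ℝ) ≤ m := m.cast_nonneg
  have e : ((p : ℂ) / d * a i).re = p / d * a i := by
    have : ((p : ℂ) / d * a i) = ((p / d * a i : ℝ) : ℂ) := by push_cast; rfl
    rw [this, ofReal_re]
  simp only [sub_re, e, natCast_re, natCast_im, mul_re, zero_mul, sub_zero, neg_re] at h2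
  have : a i * c < a i * s.re := by
    have : (a i : ℝ) * (c + p / d) = a i * c + p / d * a i := by ring
    linarith
  exact lt_of_mul_lt_mul_left this ha.le

lemma ne_neg_nat_of_re_pos (hd : 0 < d) {s : ℂ} (hs : 0 < s.re) (m : ℕ) : (d : ℂ) * s ≠ -m := by
  intro h
  have h := congrArg Complex.re h
  have hdr : (0 : ℝ) < d := by exact_mod_cast hd
  have hm0 : (0 : ℝ) ≤ m := m.cast_nonneg
  have := mul_pos hdr hs
  simp at h
  linarith

lemma verticalIntegrable_integrandTwo (hd : 0 < d) (ha : ∑ i, a i = d) (hζ : ζ ∈ sector d) {σ : ℝ}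
    (hσ : ∀ s : ℂ, s.re = σ → AnalyticAt ℂ (integrandTwo d p a α ζ) s) :
    VerticalIntegrable (integrandTwo d p a α ζ) σ := by
  obtain ⟨C, ε, T, hε, h⟩ := exists_norm_integrandTwo_le (p := p) (α := α) hd ha hζ σ σ
  exact verticalIntegrable_of_decay hε hσ fun z hz => h z (by simp [hz])

lemma norm_verticalIntegral_le {f : ℂ → ℂ} {σ τ κ : ℝ} (h : VerticalIntegrable f σ)
    (hf : ∀ t : ℝ, ‖f (τ + t * I)‖ ≤ κ * ‖f (σ + t * I)‖) :
    ‖verticalIntegral f τ‖ ≤ κ * ∫ t : ℝ, ‖f (σ + t * I)‖ := by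
  rw [verticalIntegral, norm_mul, norm_I, one_mul, ← MeasureTheory.integral_const_mul]
  exact MeasureTheory.norm_integral_le_of_norm_le (h.norm.const_mul κ)
    (Eventually.of_forall hf)

/-- Ratio test: for large k, the d factors gained by the numerator are at most 3dk and the d factors
gained by the denominator at least dk, so the ratio is at most (3|ζ|)^d. -/
lemma summable_lacunaryTerm (hd : 0 < d) (ha : ∑ i, a i = d)
    (hα : ∀ i, a i ≠ 0 → 0 < (α i).re) (hζ : ‖ζ‖ < 1 / 6) :
    Summable (lacunaryTerm d p a α ζ) := by
  have hdr : (0 : ℝ) < d := by exact_mod_cast hd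
  obtain ⟨M, hM⟩ := exists_nat_gt (1 + ∑ i, ‖α i‖)
  have hr : (3 * ‖ζ‖) ^ d < 1 := pow_lt_one₀ (by positivity) (by linarith) hd.ne'
  refine summable_of_ratio_norm_eventually_le hr ?_
  filter_upwards [eventually_ge_atTop M] with k hk
  have hk' : 1 + ∑ i, ‖α i‖ ≤ k := hM.le.trans (by exact_mod_cast hk)
  have hsum : 0 ≤ ∑ i, ‖α i‖ := Finset.sum_nonneg fun i _ => norm_nonneg _
  have hk1 : (1 : ℝ) ≤ k := by linarith
  have hαk : ∀ i, ‖α i‖ ≤ k := fun i => by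
    have := Finset.single_le_sum (f := fun i => ‖α i‖) (fun i _ => norm_nonneg _)
      (Finset.mem_univ i)
    linarith
  have hai : ∀ i, a i ≤ d := fun i => ha ▸ Finset.single_le_sum (fun i _ => Nat.zero_le (a i))
    (Finset.mem_univ i)
  have e1 : gammaProd (fun i => α i + ((k + 1 : ℕ) : ℂ) * a i) =
      (∏ i, ∏ j ∈ Finset.range (a i), (α i + (k : ℂ) * a i + j)) *
      gammaProd (fun i => α i + (k : ℂ) * a i) := by
    rw [gammaProd, gammaProd, ← Finset.prod_mul_distrib]
    refine Finset.prod_congr rfl fun i _ => ?_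
    rw [← Gamma_add_natCast_eq_prod]
    · congr 1
      push_cast
      ring
    · intro j hj h
      have h2 := congrArg Complex.re h
      have h3 := hα i (by omega)
      simp at h2
      have h4 : (0 : ℝ) ≤ k * a i := by positivity
      have h5 : (0 : ℝ) ≤ j := j.cast_nonneg
      linarith
  have hlow : ∀ j : ℕ, d * (k : ℝ) ≤ ‖1 + (p : ℂ) + d * k + j‖ := fun j => by
    have : (1 + (p : ℂ) + d * k + j) = ((1 + p + d * k + j : ℕ) : ℂ) := by push_cast; ring
    rw [this, Complex.norm_natCast]
    push_cast
    have h1 : (0 : ℝ) ≤ p := p.cast_nonneg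
    have h2 : (0 : ℝ) ≤ j := j.cast_nonneg
    linarith
  have hdk : 0 < d * (k : ℝ) := by positivity
  have e2 : Gamma (1 + p + (d : ℂ) * (k + 1 : ℕ)) =
      (∏ j ∈ Finset.range d, (1 + (p : ℂ) + d * k + j)) * Gamma (1 + p + (d : ℂ) * k) := by
    rw [← Gamma_add_natCast_eq_prod]
    · congr 1
      push_cast
      ring
    · exact fun j _ => norm_pos_iff.1 (hdk.trans_le (hlow j))
  have hN : ‖∏ i, ∏ j ∈ Finset.range (a i), (α i + (k : ℂ) * a i + j)‖ ≤ (3 * (d * k)) ^ d := by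
    have : ((3 : ℝ) * (d * k)) ^ d = ∏ i, ∏ j ∈ Finset.range (a i), (3 * (d * (k : ℝ))) := by
      simp [Finset.prod_pow_eq_pow_sum, ha]
    rw [norm_prod, this]
    refine Finset.prod_le_prod (fun _ _ => norm_nonneg _) fun i _ => ?_
    rw [norm_prod]
    refine Finset.prod_le_prod (fun _ _ => norm_nonneg _) fun j hj => ?_
    have hj := Finset.mem_range.1 hj
    have hjd : (j : ℝ) ≤ d := by exact_mod_cast (hj.le.trans (hai i))
    have had : (a i : ℝ) ≤ d := by exact_mod_cast hai i
    have hd1 : (1 : ℝ) ≤ d := by exact_mod_cast hd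
    refine (norm_add₃_le).trans ?_
    rw [norm_mul, Complex.norm_natCast, Complex.norm_natCast, Complex.norm_natCast]
    have := hαk i
    nlinarith
  have hD : (d * (k : ℝ)) ^ d ≤ ‖∏ j ∈ Finset.range d, (1 + (p : ℂ) + d * k + j)‖ := by
    rw [norm_prod]
    calc _ = ∏ j ∈ Finset.range d, (d * (k : ℝ)) := by rw [Finset.prod_const, Finset.card_range]
      _ ≤ _ := Finset.prod_le_prod (fun _ _ => hdk.le) fun j _ => hlow j
  have e3 : lacunaryTerm d p a α ζ (k + 1) =
      (∏ i, ∏ j ∈ Finset.range (a i), (α i + (k : ℂ) * a i + j)) /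
      (∏ j ∈ Finset.range d, (1 + (p : ℂ) + d * k + j)) * ζ ^ d * lacunaryTerm d p a α ζ k := by
    rw [lacunaryTerm, lacunaryTerm, e1, e2, Nat.mul_succ, pow_add]
    simp only [div_eq_mul_inv, mul_inv]
    ring
  rw [e3, norm_mul, norm_mul, norm_div, norm_pow]
  gcongr
  rw [mul_pow]
  gcongr
  rw [div_le_iff₀ ((pow_pos hdk d).trans_le hD)]
  refine hN.trans ?_
  rw [mul_pow]
  gcongr

end lines

/-! ### Small ζ: shifting the line to the left. -/

section small
variable {n d p : ℕ} {a : Fin n → ℕ} {α : Fin n → ℂ} {ζ : ℂ}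

/-- The abscissa of a line separating the poles `-m/d`, `m < p + dN`, of `Γ(ds)` from the rest. -/
def leftLine (d p N : ℕ) : ℝ := -((p + d * N - 1 / 2) / d)

lemma leftLine_add (hd : 0 < d) (N K : ℕ) : leftLine d p (N + K) = leftLine d p N - K := by
  have : (d : ℝ) ≠ 0 := by exact_mod_cast hd.ne'
  unfold leftLine
  push_cast
  field_simp
  ring

lemma lt_iff_leftLine_lt (hd : 0 < d) (m N : ℕ) : leftLine d p N < -(m / d : ℝ) ↔ m < p + d * N := by
  have : (0 : ℝ) < d := by exact_mod_cast hd
  unfold leftLine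
  rw [neg_lt_neg_iff, div_lt_div_iff_of_pos_right this]
  constructor
  · intro h
    by_contra h2
    have : ((p + d * N : ℕ) : ℝ) ≤ m := by exact_mod_cast not_lt.1 h2
    push_cast at this
    linarith
  · intro h
    have : ((m + 1 : ℕ) : ℝ) ≤ ((p + d * N : ℕ) : ℝ) := by exact_mod_cast h
    push_cast at this
    linarith

lemma leftLine_ne (hd : 0 < d) (m N : ℕ) : -(m / d : ℝ) ≠ leftLine d p N := by
  have h0 : (d : ℝ) ≠ 0 := by exact_mod_cast hd.ne'
  unfold leftLine
  intro h
  field_simp at h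
  -- The half-integer offset of `leftLine` makes this a parity contradiction.
  have h' : (2 * m + 1 : ℝ) = 2 * (p + d * N) := by linarith
  have : 2 * m + 1 = 2 * (p + d * N) := by exact_mod_cast h'
  omega

lemma verticalIntegral_sub_leftLine (hd : 0 < d) (ha : ∑ i, a i = d) {c : ℝ}
    (hc : c ∈ abscissas d p a α) (hζ : ζ ∈ sector d) {N : ℕ} (hN : leftLine d p N < c) :
    verticalIntegral (integrandTwo d p a α ζ) c -
      verticalIntegral (integrandTwo d p a α ζ) (leftLine d p N) =
    2 * Real.pi * I * ∑ m ∈ Finset.range (p + d * N),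
      residue (integrandTwo d p a α ζ) (-((m : ℂ) / d)) := by
  classical
  have hd' : (d : ℂ) ≠ 0 := by exact_mod_cast hd.ne'
  have hdr : (0 : ℝ) < d := by exact_mod_cast hd
  obtain ⟨C, ε, T, hε, h⟩ := exists_norm_integrandTwo_le (p := p) (α := α) hd ha hζ (leftLine d p N) c
  have hinj : Function.Injective (fun m : ℕ => -((m : ℂ) / d)) := fun m m' h => by
    simpa [hd'] using h
  have hre : ∀ m : ℕ, (-((m : ℂ) / d)).re = -(m / d : ℝ) := fun m => by
    have : -((m : ℂ) / d) = ((-(m / d) : ℝ) : ℂ) := by push_cast; rfl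
    rw [this, ofReal_re]
  rw [verticalIntegral_sub_eq_sum_residue hN hε
    ((Finset.range (p + d * N)).image (fun m : ℕ => -((m : ℂ) / d))) ?_
    (fun s _ => meromorphicAt_integrandTwo hζ.1 s) ?_ h, Finset.sum_image fun _ _ _ _ h => hinj h]
  · intro s hs
    obtain ⟨m, hm, rfl⟩ := Finset.mem_image.1 hs
    rw [hre]
    refine ⟨(lt_iff_leftLine_lt hd m N).2 (Finset.mem_range.1 hm), ?_⟩
    have : (0 : ℝ) ≤ m / d := by positivity
    linarith [hc.1]
  · intro z hz hzS
    refine analyticAt_integrandTwo hζ.1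
      (fun hP => absurd (lt_re_of_mem_gammaPoles hc hP) (not_lt.2 hz.2)) fun m hm => hzS ?_
    have hzm : z = -((m : ℂ) / d) := by
      field_simp
      rw [← hm]
      ring
    rw [hzm, hre] at hz
    refine Finset.mem_image.2 ⟨m, Finset.mem_range.2 ?_, hzm.symm⟩
    exact (lt_iff_leftLine_lt hd m N).1 (lt_of_le_of_ne hz.1 (leftLine_ne hd m N).symm)

theorem hasSum_lacunaryTerm (hd : 0 < d) (hp : p < d) (ha : ∑ i, a i = d) {c : ℝ}
    (hc : c ∈ abscissas d p a α) (hζ : ζ ∈ sector d) (hr : ‖ζ‖ < 1 / 6) :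
    HasSum (lacunaryTerm d p a α ζ) (integralTwo d p a α ζ c) := by
  have hdr : (0 : ℝ) < d := by exact_mod_cast hd
  have hαre : ∀ i, a i ≠ 0 → 0 < (α i).re := fun i hi => by
    have := hc.2 i hi
    have h1 := hc.1
    refine lt_of_le_of_lt ?_ this
    positivity
  have hsum := summable_lacunaryTerm (p := p) hd ha hαre hr
  -- The starting line must lie beyond `shiftRadius`; every further block of d poles moves it by one
  -- unit and costs a factor κ.
  obtain ⟨N₀, hN₀⟩ := exists_nat_gt (shiftRadius d p a α + 1)
  have hline : leftLine d p N₀ ≤ -shiftRadius d p a α := by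
    unfold leftLine
    rw [neg_le_neg_iff, le_div_iff₀ hdr]
    have h1 : (0 : ℝ) ≤ p := p.cast_nonneg
    have h2 : (1 : ℝ) ≤ d := by exact_mod_cast hd
    nlinarith
  have hlt : ∀ K, leftLine d p (N₀ + K) < c := fun K => by
    rw [leftLine_add hd]
    have h1 := two_le_shiftRadius (d := d) (p := p) (a := a) (α := α)
    have h2 : (0 : ℝ) ≤ K := K.cast_nonneg
    linarith [hc.1]
  have hnP : ∀ s : ℂ, s.re ≤ c → s ∉ gammaPoles d p a α := fun s hs hP =>
    absurd (lt_re_of_mem_gammaPoles hc hP) (not_lt.2 hs)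
  have hint : VerticalIntegrable (integrandTwo d p a α ζ) (leftLine d p N₀) := by
    refine verticalIntegrable_integrandTwo hd ha hζ fun s hs => ?_
    refine analyticAt_integrandTwo hζ.1 (hnP s (hs.trans_le (hlt 0).le)) fun m hm => ?_
    refine leftLine_ne hd m N₀ (p := p) ?_
    rw [← hs]
    have := congrArg Complex.re hm
    simp at this
    field_simp
    linarith
  set κ : ℝ := (6 * ‖ζ‖) ^ d with hκ
  have hκ1 : κ < 1 := pow_lt_one₀ (by positivity) (by linarith) hd.ne'
  have hdecay : Tendsto (fun K : ℕ => verticalIntegral (integrandTwo d p a α ζ)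
      (leftLine d p (N₀ + K))) atTop (𝓝 0) := by
    refine squeeze_zero_norm (a := fun K : ℕ => κ ^ K * ∫ t : ℝ,
      ‖integrandTwo d p a α ζ (leftLine d p N₀ + t * I)‖) (fun K => ?_) ?_
    · refine norm_verticalIntegral_le hint fun t => ?_
      have := norm_integrandTwo_sub_nat_le hd ha hζ.1 (s := leftLine d p N₀ + t * I) (p := p)
        (α := α) (by simpa using hline) K
      convert this using 3
      rw [leftLine_add hd]
      push_cast
      ring
    · simpa using (tendsto_pow_atTop_nhds_zero_of_lt_one (by positivity) hκ1).mul_const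
        (∫ t : ℝ, ‖integrandTwo d p a α ζ (leftLine d p N₀ + t * I)‖)
  have hpi : (Real.pi : ℂ) ≠ 0 := by exact_mod_cast Real.pi_ne_zero
  have hpart : ∀ K, ∑ k ∈ Finset.range (N₀ + K), lacunaryTerm d p a α ζ k =
      integralTwo d p a α ζ c - (-1) ^ p / (2 * (Real.pi : ℂ) * I) * 2 ^ (d - 1) *
        verticalIntegral (integrandTwo d p a α ζ) (leftLine d p (N₀ + K)) := fun K => by
    rw [← sum_range_residue_integrandTwo hd hp hζ.1 (fun m => hnP _ ?_), integralTwo, ← mul_sub,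
      verticalIntegral_sub_leftLine hd ha hc hζ (hlt K)]
    · field_simp
    · have : -((m : ℂ) / d) = ((-(m / d) : ℝ) : ℂ) := by push_cast; rfl
      rw [this, ofReal_re]
      have : (0 : ℝ) ≤ m / d := by positivity
      linarith [hc.1]
  have hlim : Tendsto (fun K => ∑ k ∈ Finset.range (N₀ + K), lacunaryTerm d p a α ζ k) atTop
      (𝓝 (integralTwo d p a α ζ c)) := by
    simp only [hpart]
    simpa using (hdecay.const_mul ((-1) ^ p / (2 * (Real.pi : ℂ) * I) * 2 ^ (d - 1))).const_sub
      (integralTwo d p a α ζ c)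
  -- Line shifting only gives the limit of the partial sums. Summability upgrades it to an
  -- absolutely convergent sum.
  have hlim' := hsum.hasSum.tendsto_sum_nat.comp (tendsto_add_atTop_nat N₀)
  have : ∑' k, lacunaryTerm d p a α ζ k = integralTwo d p a α ζ c := by
    refine tendsto_nhds_unique hlim' (hlim.congr fun K => ?_)
    simp [add_comm]
  exact this ▸ hsum.hasSum

end small

/-! ### Large ζ: shifting the line to the right. -/

section large
variable {n d p : ℕ} {a : Fin n → ℕ} {α : Fin n → ℂ} {ζ : ℂ}

/-- The point `(αᵢ - (p/d) aᵢ + m) / aᵢ`. -/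
def gammaPole (d p : ℕ) (a : Fin n → ℕ) (α : Fin n → ℂ) (i : Fin n) (m : ℕ) : ℂ :=
  (α i - (p : ℂ) / d * a i + m) / a i

lemma eq_gammaPole_iff {i : Fin n} (hi : a i ≠ 0) {s : ℂ} {m : ℕ} :
    α i - (p : ℂ) / d * a i - (a i : ℂ) * s = -m ↔ s = gammaPole d p a α i m := by
  have : (a i : ℂ) ≠ 0 := by exact_mod_cast hi
  rw [gammaPole, eq_div_iff this]
  constructor <;> intro h <;> linear_combination -h

/-- The candidate poles thus form finitely many progressions of step 1, one for each i and each
residue class modulo aᵢ, to match the unit shift of the integrand. -/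
lemma gammaPole_add (i : Fin n) (hi : a i ≠ 0) (j K : ℕ) :
    gammaPole d p a α i (j + a i * K) = gammaPole d p a α i j + K := by
  have : (a i : ℂ) ≠ 0 := by exact_mod_cast hi
  unfold gammaPole
  push_cast
  field_simp
  ring

lemma countable_gammaPoles : (gammaPoles d p a α).Countable := by
  refine (Set.countable_range fun x : Fin n × ℕ => gammaPole d p a α x.1 x.2).mono ?_
  rintro s ⟨i, hi, m, hm⟩
  exact ⟨(i, m), ((eq_gammaPole_iff hi).1 hm).symm⟩

lemma finite_gammaPoles_le (X : ℝ) : {s ∈ gammaPoles d p a α | s.re ≤ X}.Finite := by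
  have hb : ∃ M : ℕ, ∀ i, (a i : ℝ) * |X| + ‖α i - (p : ℂ) / d * a i‖ < M := by
    obtain ⟨M, hM⟩ := exists_nat_gt (∑ i, ((a i : ℝ) * |X| + ‖α i - (p : ℂ) / d * a i‖))
    refine ⟨M, fun i => lt_of_le_of_lt ?_ hM⟩
    exact Finset.single_le_sum (f := fun i => (a i : ℝ) * |X| + ‖α i - (p : ℂ) / d * a i‖)
      (fun i _ => by positivity) (Finset.mem_univ i)
  obtain ⟨M, hM⟩ := hb
  refine ((Finset.univ ×ˢ Finset.range M).finite_toSet.image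
    fun x : Fin n × ℕ => gammaPole d p a α x.1 x.2).subset ?_
  rintro s ⟨⟨i, hi, m, hm⟩, hs⟩
  refine ⟨(i, m), ?_, ((eq_gammaPole_iff hi).1 hm).symm⟩
  have h := congrArg Complex.re hm
  have h1 := (neg_le_abs _).trans (abs_re_le_norm (α i - (p : ℂ) / d * a i))
  rw [sub_re] at h
  simp only [mul_re, natCast_re, natCast_im, zero_mul, sub_zero, neg_re] at h
  have h2 : (a i : ℝ) * s.re ≤ a i * |X| := by
    gcongr
    exact hs.trans (le_abs_self X)
  have h3 : (m : ℝ) < M := by linarith [hM i]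
  simpa using h3

/-- If z + K had index m, then z would have index m - aᵢK. The bound on Re z makes this index
nonnegative, so z would itself be a candidate pole. -/
lemma add_natCast_notMem_gammaPoles {z : ℂ} (hz : z ∉ gammaPoles d p a α)
    (hre : shiftRadius d p a α ≤ z.re) (K : ℕ) : z + K ∉ gammaPoles d p a α := by
  rintro ⟨i, hi, m, hm⟩
  have ha : (1 : ℝ) ≤ a i := by exact_mod_cast Nat.one_le_iff_ne_zero.2 hi
  have h1 : a i * K ≤ m := by
    have h := congrArg Complex.re hm
    have h2 := (le_abs_self _).trans (abs_re_le_norm (α i - (p : ℂ) / d * a i))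
    have h3 := shiftRadius_ge (d := d) (p := p) (a := a) (α := α) i
    have h4 := norm_nonneg (α i - (p : ℂ) / d * a i)
    rw [sub_re] at h
    simp only [mul_re, add_re, natCast_re, natCast_im, zero_mul, sub_zero, neg_re] at h
    have : (a i * K : ℝ) ≤ m := by nlinarith
    exact_mod_cast this
  refine hz ⟨i, hi, m - a i * K, ?_⟩
  rw [Nat.cast_sub h1]
  push_cast
  linear_combination hm

lemma summable_residue_add_nat (hd : 0 < d) (ha : ∑ i, a i = d) (hζ : ζ ≠ 0)
    (hR : 4 * d < ‖ζ‖) (b : ℂ) :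
    Summable (fun K : ℕ => ‖residue (integrandTwo d p a α ζ) (b + K)‖) := by
  have hζ' : 0 < ‖ζ‖ := norm_pos_iff.2 hζ
  -- The extra 1 leaves room for a disc of radius ρ ≤ 1 around b' beyond `shiftRadius`. Its
  -- translates by K have no pole except perhaps at the centre, and on their boundary circles the
  -- integrand is at most κ^K M.
  obtain ⟨K₀, hK₀⟩ := exists_nat_gt (shiftRadius d p a α + 1 - b.re)
  set b' : ℂ := b + K₀ with hb'
  have hb're : shiftRadius d p a α + 1 ≤ b'.re := by simp [hb']; linarith
  have hfin : ({s ∈ gammaPoles d p a α | s.re ≤ b'.re + 1} \ {b'}).Finite :=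
    (finite_gammaPoles_le _).sdiff
  obtain ⟨ε, hε, hball⟩ := Metric.isOpen_iff.1 hfin.isClosed.isOpen_compl b' (by simp)
  set ρ := min (ε / 2) 1 with hρ
  have hρ0 : 0 < ρ := by positivity
  have hclose : ∀ z ∈ Metric.closedBall b' ρ, shiftRadius d p a α ≤ z.re ∧
      (z ≠ b' → z ∉ gammaPoles d p a α) := by
    intro z hz
    have h1 : ‖z - b'‖ ≤ ρ := by rwa [← dist_eq_norm]
    have h2 := (abs_re_le_norm _).trans h1
    have h3 : ρ ≤ 1 := min_le_right _ _
    have h4 : ρ ≤ ε / 2 := min_le_left _ _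
    rw [sub_re] at h2
    obtain ⟨h5, h6⟩ := abs_le.1 h2
    refine ⟨by linarith, fun hne hP => ?_⟩
    refine hball (Metric.mem_ball.2 (lt_of_le_of_lt hz (by linarith))) ⟨⟨hP, by linarith⟩, hne⟩
  have hpos : 0 < shiftRadius d p a α := lt_of_lt_of_le two_pos two_le_shiftRadius
  have han : ∀ K : ℕ, ∀ z ∈ Metric.closedBall b' ρ, z ≠ b' →
      AnalyticAt ℂ (fun z => integrandTwo d p a α ζ (z + K)) z := by
    intro K z hz hne
    obtain ⟨h1, h2⟩ := hclose z hz
    refine AnalyticAt.fun_comp (analyticAt_integrandTwo hζ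
      (add_natCast_notMem_gammaPoles (h2 hne) h1 K) (ne_neg_nat_of_re_pos hd ?_)) (by fun_prop)
    have : (0 : ℝ) ≤ K := K.cast_nonneg
    simp
    linarith
  obtain ⟨M, hM⟩ := (isCompact_sphere b' ρ).exists_bound_of_continuousOn
    (f := integrandTwo d p a α ζ) fun z hz => by
      have := han 0 z (Metric.sphere_subset_closedBall hz) (Metric.ne_of_mem_sphere hz hρ0.ne')
      simp only [Nat.cast_zero, add_zero] at this
      exact this.continuousAt.continuousWithinAt
  set κ : ℝ := (4 * d / ‖ζ‖) ^ d with hκ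
  have hκ0 : 0 ≤ κ := by positivity
  have hκ1 : κ < 1 := pow_lt_one₀ (by positivity) (by rwa [div_lt_one hζ']) hd.ne'
  rw [← summable_nat_add_iff K₀]
  refine Summable.of_nonneg_of_le (fun _ => norm_nonneg _) (fun K => ?_)
    ((summable_geometric_of_lt_one hκ0 hκ1).mul_left (ρ * M))
  have e : b + ((K + K₀ : ℕ) : ℂ) = b' + K := by rw [hb']; push_cast; ring
  rw [e, ← residue_comp_add]
  have := norm_residue_le (M := κ ^ K * M) hρ0 (han K) fun z hz => by
    obtain ⟨h1, _⟩ := hclose z (Metric.sphere_subset_closedBall hz)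
    refine (norm_integrandTwo_add_nat_le hd ha hζ h1 K).trans ?_
    have := hM z hz
    gcongr
  refine this.trans (le_of_eq ?_)
  ring

lemma summable_prod_of_finite {ι : Type*} [Finite ι] {f : ι × ℕ → ℝ} (hf : ∀ x, 0 ≤ f x)
    (h : ∀ i, Summable fun k => f (i, k)) : Summable f :=
  (summable_prod_of_nonneg hf).2 ⟨h, Summable.of_finite⟩

lemma summable_residue_gammaPoles (hd : 0 < d) (ha : ∑ i, a i = d) (hζ : ζ ≠ 0)
    (hR : 4 * d < ‖ζ‖) :
    Summable (fun s : gammaPoles d p a α => residue (integrandTwo d p a α ζ) s) := by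
  have h1 : Summable (fun x : (Σ i : Fin n, Fin (a i)) × ℕ =>
      ‖residue (integrandTwo d p a α ζ) (gammaPole d p a α x.1.1 x.1.2 + x.2)‖) :=
    summable_prod_of_finite (fun _ => norm_nonneg _) fun x =>
      summable_residue_add_nat (p := p) (α := α) hd ha hζ hR (gammaPole d p a α x.1 x.2)
  have hex : ∀ s : gammaPoles d p a α, ∃ x : (Σ i : Fin n, Fin (a i)) × ℕ,
      gammaPole d p a α x.1.1 x.1.2 + x.2 = s := by
    rintro ⟨s, hs⟩
    obtain ⟨i, hi, m, hm⟩ := id hs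
    -- Division of m by aᵢ finds the progression. Progressions may overlap, so one label is chosen
    -- for each pole; distinct poles get distinct labels.
    refine ⟨(⟨i, ⟨m % a i, Nat.mod_lt _ (Nat.pos_of_ne_zero hi)⟩⟩, m / a i), ?_⟩
    show gammaPole d p a α i (m % a i) + ((m / a i : ℕ) : ℂ) = s
    rw [(eq_gammaPole_iff hi).1 hm, ← gammaPole_add i hi, Nat.mod_add_div]
  choose ψ hψ using hex
  have hinj : Function.Injective ψ := fun s t h => Subtype.ext (by rw [← hψ s, ← hψ t, h])
  refine Summable.of_norm ?_
  have := h1.comp_injective hinj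
  refine this.congr fun s => ?_
  simp [hψ]

lemma rightPoles_subset_gammaPoles (hd : 0 < d) (hζ : ζ ≠ 0) :
    rightPoles (integrandTwo d p a α ζ) ⊆ gammaPoles d p a α := by
  rintro s ⟨hs, ho⟩
  by_contra hP
  exact absurd (analyticAt_integrandTwo hζ hP (ne_neg_nat_of_re_pos hd hs)).meromorphicOrderAt_nonneg
    (not_le.2 ho)

lemma residue_eq_zero_of_order_nonneg {f : ℂ → ℂ} {s : ℂ} (hf : MeromorphicAt f s)
    (ho : 0 ≤ meromorphicOrderAt f s) : residue f s = 0 := by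
  obtain ⟨g, hg, hfg⟩ := hf.meromorphicOrderAt_nonneg_iff.1 ho
  refine residue_eq_of_singularPart hg (E := fun _ => 0)
    ⟨fun _ => 0, fun z _ => ⟨analyticAt_const, by simpa using hasDerivAt_const z (0 : ℂ)⟩⟩ ?_
  filter_upwards [hfg] with z hz
  simpa using hz

/-- The translates of the real parts of countably many points do not fill an interval. With such a σ
no line Re s = σ + N meets a pole. -/
lemma exists_generic_line (X : ℝ) : ∃ σ, X < σ ∧ ∀ N : ℕ, ∀ s ∈ gammaPoles d p a α,
    s.re ≠ σ + N := by
  have hc : (⋃ N : ℕ, (fun s : ℂ => s.re - N) '' gammaPoles d p a α).Countable :=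
    Set.countable_iUnion fun N => countable_gammaPoles.image _
  obtain ⟨σ, h1, h2⟩ := (hc.dense_compl ℝ).exists_between (lt_add_one X)
  refine ⟨σ, h2.1, fun N s hs h => h1 ?_⟩
  exact Set.mem_iUnion.2 ⟨N, s, hs, by simp [h]⟩

lemma hasSum_subtype_of_indicator_eq {S T : Set ℂ} {f : ℂ → ℂ} {x : ℂ}
    (h : S.indicator f = T.indicator f) (hS : HasSum (fun s : S => f s) x) :
    HasSum (fun s : T => f s) x := by
  have h1 : HasSum (f ∘ (↑) : S → ℂ) x := hS
  rw [hasSum_subtype_iff_indicator, h] at h1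
  exact hasSum_subtype_iff_indicator.2 h1

theorem hasSum_residue (hd : 0 < d) (ha : ∑ i, a i = d) {c : ℝ}
    (hc : c ∈ abscissas d p a α) (hζ : ζ ∈ sector d) (hR : 4 * d < ‖ζ‖) :
    HasSum (fun s₀ : rightPoles (integrandTwo d p a α ζ) =>
      (-1) ^ (p + 1) * 2 ^ (d - 1) * residue (integrandTwo d p a α ζ) s₀)
      (integralTwo d p a α ζ c) := by
  classical
  set G := integrandTwo d p a α ζ with hG
  have hζ' : 0 < ‖ζ‖ := norm_pos_iff.2 hζ.1
  obtain ⟨σ, hσ, hgen⟩ := exists_generic_line (d := d) (p := p) (a := a) (α := α)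
    (max c (shiftRadius d p a α))
  have hσc : c < σ := (le_max_left _ _).trans_lt hσ
  have hσB : shiftRadius d p a α < σ := (le_max_right _ _).trans_lt hσ
  have han : ∀ s : ℂ, c ≤ s.re → s ∉ gammaPoles d p a α → AnalyticAt ℂ G s := fun s hs hP =>
    analyticAt_integrandTwo hζ.1 hP (ne_neg_nat_of_re_pos hd (hc.1.trans_le hs))
  have hint : VerticalIntegrable G σ := verticalIntegrable_integrandTwo hd ha hζ fun s hs =>
    han s (by linarith) fun hP => hgen 0 s hP (by simpa using hs)
  set κ : ℝ := (4 * d / ‖ζ‖) ^ d with hκ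
  have hκ0 : 0 ≤ κ := by positivity
  have hκ1 : κ < 1 := pow_lt_one₀ (by positivity) (by rwa [div_lt_one hζ']) hd.ne'
  have hdecay : Tendsto (fun K : ℕ => verticalIntegral G (σ + K)) atTop (𝓝 0) := by
    refine squeeze_zero_norm (a := fun K : ℕ => κ ^ K * ∫ t : ℝ, ‖G (σ + t * I)‖) (fun K => ?_) ?_
    · refine norm_verticalIntegral_le hint fun t => ?_
      have := norm_integrandTwo_add_nat_le hd ha hζ.1 (s := σ + t * I) (p := p)
        (α := α) (by simpa using hσB.le) K
      refine le_trans (le_of_eq ?_) this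
      congr 2
      push_cast
      ring
    · simpa using (tendsto_pow_atTop_nhds_zero_of_lt_one hκ0 hκ1).mul_const
        (∫ t : ℝ, ‖G (σ + t * I)‖)
  set S : ℕ → Finset ℂ := fun K => (finite_gammaPoles_le (d := d) (p := p) (a := a) (α := α)
    (σ + K)).toFinset with hS
  have hmem : ∀ K s, s ∈ S K ↔ s ∈ gammaPoles d p a α ∧ s.re ≤ σ + K := fun K s => by simp [hS]
  have hshift : ∀ K : ℕ, verticalIntegral G (σ + K) - verticalIntegral G c =
      2 * Real.pi * I * ∑ s ∈ S K, residue G s := fun K => by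
    have hK : (0 : ℝ) ≤ K := K.cast_nonneg
    obtain ⟨C, ε, T, hε, h⟩ := exists_norm_integrandTwo_le (p := p) (α := α) hd ha hζ c (σ + K)
    refine verticalIntegral_sub_eq_sum_residue (by linarith) hε (S K) (fun s hs => ?_)
      (fun s _ => meromorphicAt_integrandTwo hζ.1 s) (fun z hz hzS => ?_) h
    · obtain ⟨h1, h2⟩ := (hmem K s).1 hs
      exact ⟨lt_re_of_mem_gammaPoles hc h1, lt_of_le_of_ne h2 (hgen K s h1)⟩
    · exact han z hz.1 fun hP => hzS ((hmem K z).2 ⟨hP, hz.2⟩)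
  have hsum := summable_residue_gammaPoles (p := p) (α := α) hd ha hζ.1 hR
  -- The finite sets of poles cut off by Re s ≤ σ + K exhaust all candidates, so the partial sums
  -- tend to the unordered sum.
  have hT : Tendsto (fun K => (S K).subtype (· ∈ gammaPoles d p a α)) atTop atTop := by
    refine tendsto_atTop_finset_of_monotone (fun K L hKL s hs => ?_) fun s => ?_
    · rw [Finset.mem_subtype, hmem] at hs ⊢
      have : (K : ℝ) ≤ L := by exact_mod_cast hKL
      exact ⟨hs.1, by linarith [hs.2]⟩
    · obtain ⟨K, hK⟩ := exists_nat_ge ((s : ℂ).re - σ)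
      exact ⟨K, by rw [Finset.mem_subtype, hmem]; exact ⟨s.2, by linarith⟩⟩
  have hlim := hsum.hasSum.comp hT
  have hsub : ∀ K, ∑ s ∈ (S K).subtype (· ∈ gammaPoles d p a α), residue G s =
      ∑ s ∈ S K, residue G s := fun K =>
    Finset.sum_subtype_of_mem (residue G) fun s hs => ((hmem K s).1 hs).1
  have hpi : (Real.pi : ℂ) ≠ 0 := by exact_mod_cast Real.pi_ne_zero
  have hlim2 : Tendsto (fun K => ∑ s ∈ S K, residue G s) atTop
      (𝓝 (-(2 * Real.pi * I)⁻¹ * verticalIntegral G c)) := by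
    have h1 : ∀ K, ∑ s ∈ S K, residue G s =
        (2 * Real.pi * I)⁻¹ * (verticalIntegral G (σ + K) - verticalIntegral G c) := fun K => by
      rw [hshift K]
      field_simp
    simp only [h1]
    simpa using (hdecay.sub_const (verticalIntegral G c)).const_mul (2 * Real.pi * I)⁻¹
  have htsum := tendsto_nhds_unique hlim (hlim2.congr fun K => (hsub K).symm)
  have hP : HasSum (fun s : gammaPoles d p a α => residue G s)
      (-(2 * Real.pi * I)⁻¹ * verticalIntegral G c) := htsum ▸ hsum.hasSum
  -- Candidates at which the singularity is removable have residue 0, so summing over actual poles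
  -- gives the same result.
  have hind : (gammaPoles d p a α).indicator (residue G) = (rightPoles G).indicator (residue G) := by
    ext s
    by_cases h1 : s ∈ rightPoles G
    · rw [Set.indicator_of_mem h1, Set.indicator_of_mem (rightPoles_subset_gammaPoles hd hζ.1 h1)]
    · rw [Set.indicator_of_notMem h1]
      refine Set.indicator_apply_eq_zero.2 fun h2 => ?_
      refine residue_eq_zero_of_order_nonneg (meromorphicAt_integrandTwo hζ.1 s) ?_
      by_contra h3
      exact h1 ⟨hc.1.trans (lt_re_of_mem_gammaPoles hc h2), not_le.1 h3⟩
  have hP' : HasSum (fun s : rightPoles G => residue G s)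
      (-(2 * Real.pi * I)⁻¹ * verticalIntegral G c) :=
    hasSum_subtype_of_indicator_eq hind hP
  -- The poles lie to the right of the upward line, hence the extra minus sign in (-1)^(p+1).
  have e : integralTwo d p a α ζ c = (-1) ^ (p + 1) * 2 ^ (d - 1) *
      (-(2 * Real.pi * I)⁻¹ * verticalIntegral G c) := by
    rw [integralTwo, pow_succ, ← hG]
    field_simp
  rw [e]
  exact hP'.mul_left _

end large

lemma verticalIntegrable_integrandTwo_of_mem_abscissas {n d p : ℕ} {a : Fin n → ℕ} {α : Fin n → ℂ}
    {ζ : ℂ} (hd : 0 < d) (ha : ∑ i, a i = d) {c : ℝ} (hc : c ∈ abscissas d p a α)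
    (hζ : ζ ∈ sector d) : VerticalIntegrable (integrandTwo d p a α ζ) c :=
  verticalIntegrable_integrandTwo hd ha hζ fun _ hs => analyticAt_integrandTwo hζ.1
    (fun hP => absurd (lt_re_of_mem_gammaPoles hc hP) (not_lt.2 hs.le))
    (ne_neg_nat_of_re_pos hd (hc.1.trans_eq hs.symm))

end MellinBarnes

end

theorem theorem5p3 (n d p : ℕ) (hd : 0 < d) (hp : p < d)
    (a : Fin n → ℕ) (α : Fin n → ℂ) (ha : ∑ i, a i = d)
    (hα : ∀ i, a i ≠ 0 → 0 < (α i - (a i : ℂ)).re)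
    (hα₀ : ∀ i, a i = 0 → ∀ m : ℕ, α i ≠ -(m : ℂ)) :
    -- the two integrals converge absolutely on the whole sector and coincide
    (∀ c ∈ MellinBarnes.abscissas d p a α, ∀ ζ ∈ MellinBarnes.sector d,
      Complex.VerticalIntegrable (MellinBarnes.integrandOne d p a α ζ) ((d : ℝ) * c + p) ∧
      Complex.VerticalIntegrable (MellinBarnes.integrandTwo d p a α ζ) c ∧
      MellinBarnes.integralOne d p a α ζ ((d : ℝ) * c + p) =
        MellinBarnes.integralTwo d p a α ζ c) ∧
    -- for small `ζ` in the sector the integral is the sum of the lacunary series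
    (∃ r : ℝ, 0 < r ∧ ∀ c ∈ MellinBarnes.abscissas d p a α, ∀ ζ ∈ MellinBarnes.sector d,
      ‖ζ‖ < r →
        HasSum (MellinBarnes.lacunaryTerm d p a α ζ)
          (MellinBarnes.integralOne d p a α ζ ((d : ℝ) * c + p))) ∧
    -- for large `ζ` in the sector it is the sum of residues in the right half plane
    (∃ R : ℝ, 0 < R ∧ ∀ c ∈ MellinBarnes.abscissas d p a α, ∀ ζ ∈ MellinBarnes.sector d,
      R < ‖ζ‖ →
        HasSum
          (fun s₀ : ↥(MellinBarnes.rightPoles (MellinBarnes.integrandTwo d p a α ζ)) =>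
            (-1) ^ (p + 1) * 2 ^ (d - 1) *
              MellinBarnes.residue (MellinBarnes.integrandTwo d p a α ζ) (s₀ : ℂ))
          (MellinBarnes.integralOne d p a α ζ ((d : ℝ) * c + p))) := by
  refine ⟨fun c hc ζ hζ => ?_, ⟨1 / 6, by norm_num, fun c hc ζ hζ hr => ?_⟩,
    ⟨4 * d, by positivity, fun c hc ζ hζ hR => ?_⟩⟩
  · have h := MellinBarnes.verticalIntegrable_integrandTwo_of_mem_abscissas hd ha hc hζ
    exact ⟨MellinBarnes.verticalIntegrable_integrandOne hd hc.1 h, h,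
      MellinBarnes.integralOne_eq_integralTwo hd hc.1⟩
  · rw [MellinBarnes.integralOne_eq_integralTwo hd hc.1]
    exact MellinBarnes.hasSum_lacunaryTerm hd hp ha hc hζ hr
  · rw [MellinBarnes.integralOne_eq_integralTwo hd hc.1]
    exact MellinBarnes.hasSum_residue hd ha hc hζ hR
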